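/- Let $b\ge 1$ be an integer, $\gamma:=1/(2b)$, and $r_\gamma(\xi,\eta):=(1+|\xi|^2+|\eta|^{2\gamma})^{1/2}$ for $\xi,\eta\in\mathbb R$. Let $\mathcal M$ be the class of all Borel functions $\varphi:[1,\infty)\to(0,\infty)$ such that $\varphi$ and $1/\varphi$ are bounded on each $[1,c]$, $1<c<\infty$, and $\varphi(\lambda r)/\varphi(r)\to1$ as $r\to\infty$ for every $\lambda>0$. For $s\in\mathbb R$ and $\varphi\in\mathcal M$ let $H^{s,s\gamma,\varphi}(\mathbb R^2)$ be the space of all $w\in\mathcal S'(\mathbb R^2)$ whose Fourier transform $\widetilde w$ (extending $\widetilde w(\xi,\eta)=\int e^{-i(x\xi+t\eta)}w(x,t)\,dx\,dt$) is locally integrable with $$\|w\|_{H^{s,s\gamma,\varphi}(\mathbb R^2)}^2:=\iint_{\mathbb R^2} r_\gamma^{2s}(\xi,\eta)\,\varphi^2(r_\gamma(\xi,\eta))\,|\widetilde w(\xi,\eta)|^2\,d\xi\,d\eta<\infty,$$ with the corresponding inner product, and let $H^{s,s\gamma}(\mathbb R^2)$ be this space for $\varphi\equiv1$. A couple $[X_0,X_1]$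 of separable complex Hilbert spaces with a continuous dense embedding $X_1\hookrightarrow X_0$ is called admissible. Its generating operator is the unique positive self-adjoint operator $J$ on $X_0$ with domain $X_1$ that is an isometric isomorphism of $X_1$ onto $X_0$. Let $\mathcal B$ be the class of Borel functions $\psi:(0,\infty)\to(0,\infty)$ that are bounded on each $[a,c]$, $0<a<c<\infty$, and for which $1/\psi$ is bounded on each $[a,\infty)$, $a>0$. For $\psi\in\mathcal B$, $[X_0,X_1]_\psi$ is the domain of the operator $\psi(J)$ (the Borel function $\psi$ of $J$) with the norm $\|\psi(J)u\|_{X_0}$. **Lemma 5.1.** Let $s,s_0,s_1\in\mathbb R$, $s_0<s<s_1$, $\varphi\in\mathcal M$, and $$\psi(r):=\begin{cases} r^{(s-s_0)/(s_1-s_0)}\,\varphi\bigl(r^{1/(s_1-s_0)}\bigr), & r\ge1,\\ \varphi(1), & 0<r<1.\end{cases}$$ Then the couple $[H^{s_0,s_0\gamma}(\mathbb R^2),H^{s_1,s_1\gamma}(\mathbb R^2)]$ is admissible and has a unique generating operator $J$, $\psi\in\mathcal B$, the operator $\psi(J)$ is uniquely defined by the spectral resolution of $J$, and $$H^{s,s\gamma,\varphi}(\mathbb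 R^2)=\bigl[H^{s_0,s_0\gamma}(\mathbb R^2),H^{s_1,s_1\gamma}(\mathbb R^2)\bigr]_\psi$$ with equality of norms. -/

import Mathlib

open MeasureTheory Filter Topology Set
open scoped SchwartzMap FourierTransform ENNReal InnerProductSpace ComplexConjugate

noncomputable section

/-! ### The frequency plane and the Fourier transform -/

/-- The Euclidean plane; `x 0` is the first and `x 1` the second coordinate. -/
abbrev Plane := EuclideanSpace ℝ (Fin 2)

/-- The dilation `x ↦ x / (2π)` of the plane. -/
def planeDilation : Plane ≃L[ℝ] Plane :=
  ContinuousLinearEquiv.smulLeft (Units.mk0 ((2 * Real.pi)⁻¹) (by positivity))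

/-- The Fourier transform `χ ↦ (x ↦ ∫ e^{-i⟨x,ξ⟩} χ(ξ) dξ)` on Schwartz functions
(Mathlib's `𝓕` has the kernel `e^{-2πi⟨x,ξ⟩}`, hence the dilation). -/
def angularFourier : 𝓢(Plane, ℂ) →L[ℂ] 𝓢(Plane, ℂ) :=
  (SchwartzMap.compCLMOfContinuousLinearEquiv ℂ planeDilation) ∘L
    (FourierTransform.fourierCLM ℂ 𝓢(Plane, ℂ))

theorem angularFourier_apply (χ : 𝓢(Plane, ℂ)) (x : Plane) :
    angularFourier χ x = ∫ ξ, Complex.exp (-(Complex.I * (⟪x, ξ⟫_ℝ : ℝ))) * χ ξ := by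
  have h1 : angularFourier χ x = (𝓕 (χ : Plane → ℂ)) ((2 * Real.pi)⁻¹ • x) := by
    rw [← SchwartzMap.fourier_coe]; rfl
  rw [h1, Real.fourier_eq']
  refine integral_congr_ae (ae_of_all _ fun ξ => ?_)
  simp only [inner_smul_right, smul_eq_mul, real_inner_comm]
  congr 2
  push_cast
  have : (Real.pi : ℂ) ≠ 0 := by exact_mod_cast Real.pi_ne_zero
  field_simp

def angularFourierInv : 𝓢(Plane, ℂ) →L[ℂ] 𝓢(Plane, ℂ) :=
  (FourierTransform.fourierInvCLM ℂ 𝓢(Plane, ℂ)) ∘L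
    (SchwartzMap.compCLMOfContinuousLinearEquiv ℂ planeDilation.symm)

theorem angularFourier_angularFourierInv (χ : 𝓢(Plane, ℂ)) :
    angularFourier (angularFourierInv χ) = χ := by
  ext x
  simp [angularFourier, angularFourierInv]

theorem angularFourierInv_angularFourier (χ : 𝓢(Plane, ℂ)) :
    angularFourierInv (angularFourier χ) = χ := by
  have : (SchwartzMap.compCLMOfContinuousLinearEquiv ℂ planeDilation.symm)
      (angularFourier χ) = 𝓕 χ := by
    ext x
    simp [angularFourier]
  simp [angularFourierInv, this]

/-- `g` is a locally integrable function and the Fourier transform of the tempered distribution `w`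
is (the regular tempered distribution given by) `g`. The Fourier transform of `w` is the functional
`χ ↦ w (angularFourier χ)`. -/
def IsFourierDensity (w : 𝓢'(Plane, ℂ)) (g : Plane → ℂ) : Prop :=
  LocallyIntegrable g ∧ ∀ χ : 𝓢(Plane, ℂ),
    Integrable (fun ξ => χ ξ * g ξ) ∧ w (angularFourier χ) = ∫ ξ, χ ξ * g ξ

theorem IsFourierDensity.ae_eq {w : 𝓢'(Plane, ℂ)} {g₁ g₂ : Plane → ℂ}
    (h₁ : IsFourierDensity w g₁) (h₂ : IsFourierDensity w g₂) : g₁ =ᵐ[volume] g₂ := by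
  refine ae_eq_of_integral_contDiff_smul_eq h₁.1 h₂.1 fun f hf hc => ?_
  have hc' : HasCompactSupport (Complex.ofRealCLM ∘ f) := hc.comp_left rfl
  have hf' : ContDiff ℝ (⊤ : ℕ∞) (Complex.ofRealCLM ∘ f) := by fun_prop
  have e := (h₁.2 (hc'.toSchwartzMap hf')).2.symm.trans (h₂.2 (hc'.toSchwartzMap hf')).2
  simpa using e

theorem IsFourierDensity.add {w₁ w₂ : 𝓢'(Plane, ℂ)} {g₁ g₂ : Plane → ℂ}
    (h₁ : IsFourierDensity w₁ g₁) (h₂ : IsFourierDensity w₂ g₂) :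
    IsFourierDensity (w₁ + w₂) (g₁ + g₂) := by
  refine ⟨h₁.1.add h₂.1, fun χ => ?_⟩
  obtain ⟨i₁, e₁⟩ := h₁.2 χ
  obtain ⟨i₂, e₂⟩ := h₂.2 χ
  simp only [Pi.add_apply, mul_add]
  refine ⟨i₁.add i₂, ?_⟩
  rw [integral_add i₁ i₂, ← e₁, ← e₂]; rfl

theorem IsFourierDensity.smul {w : 𝓢'(Plane, ℂ)} {g : Plane → ℂ}
    (h : IsFourierDensity w g) (c : ℂ) : IsFourierDensity (c • w) (c • g) := by
  refine ⟨h.1.smul c, fun χ => ?_⟩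
  obtain ⟨i, e⟩ := h.2 χ
  have : ∀ ξ, χ ξ * (c • g) ξ = c * (χ ξ * g ξ) := fun ξ => by
    simp only [Pi.smul_apply, smul_eq_mul]; ring
  simp only [this]
  refine ⟨i.const_mul c, ?_⟩
  rw [integral_const_mul, ← e]; rfl

theorem IsFourierDensity.zero : IsFourierDensity 0 0 := by
  refine ⟨locallyIntegrable_zero, fun χ => ?_⟩
  simp

theorem IsFourierDensity.eq_zero {w : 𝓢'(Plane, ℂ)} {g : Plane → ℂ}
    (h : IsFourierDensity w g) (hg : g =ᵐ[volume] 0) : w = 0 := by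
  ext χ
  rw [← angularFourier_angularFourierInv χ, (h.2 _).2]
  refine (integral_congr_ae (g := fun _ => (0 : ℂ)) ?_).trans (by simp)
  filter_upwards [hg] with ξ hξ
  simp [hξ]

/-! ### Function parameters -/

/-- The class of function parameters: Borel functions `φ : [1,∞) → (0,∞)` that are bounded together
with `1/φ` on every compact `[1,c]` and vary slowly at infinity in the sense of Karamata.
Such a function is stored as a function on `ℝ` whose values outside `[1,∞)` are ignored. -/
structure SlowParam where
  toFun : ℝ → ℝ
  measurable' : Measurable (fun r : Ici (1 : ℝ) => toFun r)
  pos' : ∀ r, 1 ≤ r → 0 < toFun r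
  bounded' : ∀ c, 1 < c → ∃ C, ∀ r ∈ Icc 1 c, toFun r ≤ C ∧ (toFun r)⁻¹ ≤ C
  slow' : ∀ l : ℝ, 0 < l → Tendsto (fun r => toFun (l * r) / toFun r) atTop (𝓝 1)

instance : CoeFun SlowParam fun _ => ℝ → ℝ := ⟨SlowParam.toFun⟩

/-- The parameter `φ ≡ 1`. -/
instance : One SlowParam where
  one :=
    { toFun := fun _ => 1
      measurable' := measurable_const
      pos' := fun _ _ => one_pos
      bounded' := fun _ _ => ⟨1, fun _ _ => by simp⟩
      slow' := fun _ _ => by simp }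

@[simp] theorem SlowParam.one_apply (r : ℝ) : (1 : SlowParam) r = 1 := rfl

/-! ### The refined anisotropic Sobolev spaces over the plane -/

/-- The anisotropy parameter `γ = 1/(2b)`. -/
def anisotropy (b : ℕ) : ℝ := 1 / (2 * (b : ℝ))

/-- `r_γ(ξ,η) = (1 + |ξ|² + |η|^{2γ})^{1/2}` with `γ = 1/(2b)`. -/
def rGamma (b : ℕ) (x : Plane) : ℝ :=
  Real.sqrt (1 + |x 0| ^ 2 + |x 1| ^ (2 * anisotropy b))

theorem one_le_rGamma (b : ℕ) (x : Plane) : 1 ≤ rGamma b x := by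
  refine Real.one_le_sqrt.mpr ?_
  have := Real.rpow_nonneg (abs_nonneg (x 1)) (2 * anisotropy b)
  nlinarith [sq_nonneg |x 0|]

theorem rGamma_pos (b : ℕ) (x : Plane) : 0 < rGamma b x := one_pos.trans_le (one_le_rGamma b x)

theorem continuous_rGamma (b : ℕ) : Continuous (rGamma b) := by
  have h : (0 : ℝ) ≤ 2 * anisotropy b := by unfold anisotropy; positivity
  unfold rGamma
  refine Real.continuous_sqrt.comp (Continuous.add (by fun_prop) ?_)
  exact Continuous.rpow_const (by fun_prop) fun _ => Or.inr h

/-- `μ(ξ,η) = r_γ(ξ,η)^s φ(r_γ(ξ,η))`. -/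
def rWeight (b : ℕ) (s : ℝ) (φ : SlowParam) (x : Plane) : ℝ :=
  rGamma b x ^ s * φ (rGamma b x)

theorem rWeight_pos (b : ℕ) (s : ℝ) (φ : SlowParam) (x : Plane) : 0 < rWeight b s φ x :=
  mul_pos (Real.rpow_pos_of_pos (rGamma_pos b x) s) (φ.pos' _ (one_le_rGamma b x))

theorem measurable_rWeight (b : ℕ) (s : ℝ) (φ : SlowParam) : Measurable (rWeight b s φ) := by
  refine ((continuous_rGamma b).measurable.pow_const s).mul ?_
  exact φ.measurable'.comp
    ((continuous_rGamma b).measurable.subtype_mk (h := fun x => one_le_rGamma b x))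

theorem memLp_rWeight_iff {b : ℕ} {s : ℝ} {φ : SlowParam} {g : Plane → ℂ}
    (hg : AEStronglyMeasurable g) :
    MemLp (fun ξ => (rWeight b s φ ξ : ℂ) * g ξ) 2 ↔
      Integrable (fun ξ => rGamma b ξ ^ (2 * s) * φ (rGamma b ξ) ^ 2 * ‖g ξ‖ ^ 2) := by
  have hm : AEStronglyMeasurable (fun ξ => (rWeight b s φ ξ : ℂ) * g ξ) :=
    (Complex.measurable_ofReal.comp (measurable_rWeight b s φ)).aestronglyMeasurable.mul hg
  rw [memLp_two_iff_integrable_sq_norm hm]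
  refine integrable_congr (ae_of_all _ fun ξ => ?_)
  simp only [norm_mul, Complex.norm_real, Real.norm_eq_abs, mul_pow, sq_abs, rWeight]
  rw [two_mul, Real.rpow_add (rGamma_pos b ξ)]
  ring

/-- The linear space `H^{s,sγ,φ}(ℝ²)`, `γ = 1/(2b)`, as a subspace of `𝓢'(ℝ²)`: the tempered
distributions whose Fourier transform is a locally integrable function `g` with
`∫ r_γ^{2s} φ²(r_γ) |g|² < ∞`. -/
def refinedSobolev (b : ℕ) (s : ℝ) (φ : SlowParam) : Submodule ℂ 𝓢'(Plane, ℂ) where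
  carrier := {w | ∃ g : Plane → ℂ, IsFourierDensity w g ∧
    Integrable (fun ξ => rGamma b ξ ^ (2 * s) * φ (rGamma b ξ) ^ 2 * ‖g ξ‖ ^ 2)}
  zero_mem' := ⟨0, .zero, by simp⟩
  add_mem' := by
    rintro w₁ w₂ ⟨g₁, h₁, i₁⟩ ⟨g₂, h₂, i₂⟩
    refine ⟨g₁ + g₂, h₁.add h₂, ?_⟩
    rw [← memLp_rWeight_iff h₁.1.aestronglyMeasurable] at i₁
    rw [← memLp_rWeight_iff h₂.1.aestronglyMeasurable] at i₂
    rw [← memLp_rWeight_iff (h₁.1.aestronglyMeasurable.add h₂.1.aestronglyMeasurable)]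
    simpa only [Pi.add_apply, mul_add] using! i₁.add i₂
  smul_mem' := by
    rintro c w ⟨g, h, i⟩
    refine ⟨c • g, h.smul c, ?_⟩
    have := i.const_mul (‖c‖ ^ 2)
    refine this.congr (ae_of_all _ fun ξ => ?_)
    simp only [Pi.smul_apply, norm_smul]
    ring

/-- The space `H^{s,sγ,φ}(ℝ²)` as a type, so that it carries its own norm. -/
def RefinedSobolev (b : ℕ) (s : ℝ) (φ : SlowParam) : Type := refinedSobolev b s φ

namespace RefinedSobolev

variable {b : ℕ} {s : ℝ} {φ : SlowParam}

instance : AddCommGroup (RefinedSobolev b s φ) :=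
  inferInstanceAs (AddCommGroup (refinedSobolev b s φ))
instance : Module ℂ (RefinedSobolev b s φ) :=
  inferInstanceAs (Module ℂ (refinedSobolev b s φ))

/-- The underlying tempered distribution. -/
def toDist : RefinedSobolev b s φ →ₗ[ℂ] 𝓢'(Plane, ℂ) := (refinedSobolev b s φ).subtype

theorem toDist_injective : Function.Injective (toDist : RefinedSobolev b s φ → 𝓢'(Plane, ℂ)) :=
  Subtype.val_injective

/-- The Fourier transform of `w`, a function on the plane. -/
def fourier (w : RefinedSobolev b s φ) : Plane → ℂ := w.2.choose

theorem isFourierDensity (w : RefinedSobolev b s φ) : IsFourierDensity (toDist w) w.fourier :=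
  w.2.choose_spec.1

theorem memLp (w : RefinedSobolev b s φ) :
    MemLp (fun ξ => (rWeight b s φ ξ : ℂ) * w.fourier ξ) 2 :=
  (memLp_rWeight_iff w.isFourierDensity.1.aestronglyMeasurable).2 w.2.choose_spec.2

/-- The map `w ↦ μ ŵ` into `L₂(ℝ²)`. -/
def toL2 : RefinedSobolev b s φ →ₗ[ℂ] Lp ℂ 2 (volume : Measure Plane) where
  toFun w := w.memLp.toLp _
  map_add' w₁ w₂ := by
    rw [← MemLp.toLp_add]
    refine MemLp.toLp_congr _ _ ?_
    have h : IsFourierDensity (toDist (w₁ + w₂)) (w₁.fourier + w₂.fourier) := by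
      rw [map_add]; exact w₁.isFourierDensity.add w₂.isFourierDensity
    filter_upwards [(w₁ + w₂).isFourierDensity.ae_eq h] with ξ hξ
    simp [hξ, mul_add]
  map_smul' c w := by
    rw [RingHom.id_apply, ← MemLp.toLp_const_smul]
    refine MemLp.toLp_congr _ _ ?_
    have h : IsFourierDensity (toDist (c • w)) (c • w.fourier) := by
      rw [map_smul]; exact w.isFourierDensity.smul c
    filter_upwards [(c • w).isFourierDensity.ae_eq h] with ξ hξ
    simp only [hξ, Pi.smul_apply, smul_eq_mul]
    ring

theorem toL2_injective :
    Function.Injective (toL2 : RefinedSobolev b s φ → Lp ℂ 2 (volume : Measure Plane)) := by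
  refine (injective_iff_map_eq_zero _).2 fun w hw => ?_
  have h0 : (fun ξ => (rWeight b s φ ξ : ℂ) * w.fourier ξ) =ᵐ[volume] 0 := by
    have e : (toL2 w : Plane → ℂ) =ᵐ[volume] _ := w.memLp.coeFn_toLp
    rw [hw] at e
    exact e.symm.trans (Lp.coeFn_zero ℂ 2 volume)
  refine toDist_injective ?_
  rw [map_zero]
  refine w.isFourierDensity.eq_zero ?_
  filter_upwards [h0] with ξ hξ
  have := (rWeight_pos b s φ ξ).ne'
  simpa [this] using hξ

instance : NormedAddCommGroup (RefinedSobolev b s φ) :=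
  NormedAddCommGroup.induced (RefinedSobolev b s φ) (Lp ℂ 2 (volume : Measure Plane)) toL2
    toL2_injective

instance : InnerProductSpace ℂ (RefinedSobolev b s φ) where
  norm_smul_le c w := by
    change ‖toL2 (c • w)‖ ≤ ‖c‖ * ‖toL2 w‖
    rw [map_smul, norm_smul]
  inner w₁ w₂ := ⟪toL2 w₁, toL2 w₂⟫_ℂ
  norm_sq_eq_re_inner w := norm_sq_eq_re_inner (𝕜 := ℂ) (toL2 w)
  conj_inner_symm _ _ := inner_conj_symm _ _
  add_left _ _ _ := by simp [inner_add_left]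
  smul_left _ _ _ := by simp [inner_smul_left]

/-- The inner product is `∫ r_γ^{2s} φ²(r_γ) ŵ₁ \overline{ŵ₂}` (in Mathlib's convention an inner
product is linear in the second argument). -/
theorem inner_eq (w₁ w₂ : RefinedSobolev b s φ) :
    ⟪w₂, w₁⟫_ℂ = ∫ ξ, ((rGamma b ξ ^ (2 * s) * φ (rGamma b ξ) ^ 2 : ℝ) : ℂ) *
      (w₁.fourier ξ * conj (w₂.fourier ξ)) := by
  change ⟪toL2 w₂, toL2 w₁⟫_ℂ = _
  rw [L2.inner_def]
  refine integral_congr_ae ?_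
  filter_upwards [w₁.memLp.coeFn_toLp, w₂.memLp.coeFn_toLp] with ξ h₁ h₂
  change ⟪(w₂.memLp.toLp _ : Plane → ℂ) ξ, (w₁.memLp.toLp _ : Plane → ℂ) ξ⟫_ℂ = _
  rw [h₁, h₂, two_mul, Real.rpow_add (rGamma_pos b ξ)]
  simp only [RCLike.inner_apply, map_mul, Complex.conj_ofReal, rWeight]
  push_cast
  ring

theorem norm_sq_eq (w : RefinedSobolev b s φ) :
    ‖w‖ ^ 2 = ∫ ξ, rGamma b ξ ^ (2 * s) * φ (rGamma b ξ) ^ 2 * ‖w.fourier ξ‖ ^ 2 := by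
  have h : ((‖w‖ ^ 2 : ℝ) : ℂ) = ⟪w, w⟫_ℂ := by
    rw [inner_self_eq_norm_sq_to_K]; norm_cast
  rw [← Complex.ofReal_inj, h, inner_eq, ← integral_complex_ofReal]
  refine integral_congr_ae (ae_of_all _ fun ξ => ?_)
  simp only [Complex.mul_conj, Complex.normSq_eq_norm_sq]
  push_cast
  ring

end RefinedSobolev

/-- The anisotropic Sobolev space `H^{s,sγ}(ℝ²)`: the case `φ ≡ 1`. -/
abbrev AnisoSobolev (b : ℕ) (s : ℝ) : Type := RefinedSobolev b s 1

namespace AnisoSobolev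

theorem rGamma_sq_le (b : ℕ) (x : Plane) : rGamma b x ^ 2 ≤ 2 * (1 + ‖x‖ ^ 2) := by
  have h0 : 0 ≤ 2 * anisotropy b := by unfold anisotropy; positivity
  have h1 : 2 * anisotropy b ≤ 1 := by
    unfold anisotropy
    rcases Nat.eq_zero_or_pos b with rfl | hb
    · simp
    · have : (1 : ℝ) ≤ b := by exact_mod_cast hb
      rw [← mul_div_assoc, mul_one, div_le_one (by positivity)]
      linarith
  have h2 : |x 1| ^ (2 * anisotropy b) ≤ 1 + |x 1| ^ 2 := by
    rcases le_total |x 1| 1 with h | h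
    · exact (Real.rpow_le_one (abs_nonneg _) h h0).trans (by nlinarith [sq_nonneg |x 1|])
    · refine (Real.rpow_le_rpow_of_exponent_le h h1).trans ?_
      rw [Real.rpow_one]; nlinarith
  have h3 : 0 ≤ |x 1| ^ (2 * anisotropy b) := Real.rpow_nonneg (abs_nonneg _) _
  rw [rGamma, Real.sq_sqrt (by positivity), EuclideanSpace.norm_sq_eq, Fin.sum_univ_two]
  simp only [Real.norm_eq_abs]
  nlinarith [sq_nonneg |x 0|, sq_nonneg |x 1|]

theorem inv_rWeight_le (b : ℕ) (s : ℝ) (x : Plane) :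
    (rWeight b s 1 x)⁻¹ ≤ 2 ^ (|s| / 2) * (1 + ‖x‖ ^ 2) ^ (|s| / 2) := by
  have hr := one_le_rGamma b x
  have hr0 := rGamma_pos b x
  rw [← Real.mul_rpow (by norm_num) (by positivity)]
  calc (rWeight b s 1 x)⁻¹ = rGamma b x ^ (-s) := by
        simp [rWeight, Real.rpow_neg hr0.le]
    _ ≤ rGamma b x ^ |s| := Real.rpow_le_rpow_of_exponent_le hr (neg_le_abs s)
    _ = (rGamma b x ^ 2) ^ (|s| / 2) := by
        rw [← Real.rpow_natCast, ← Real.rpow_mul hr0.le]; congr 1; push_cast; ring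
    _ ≤ _ := Real.rpow_le_rpow (by positivity) (rGamma_sq_le b x) (by positivity)

theorem toL2_surjective (b : ℕ) (s : ℝ) :
    Function.Surjective
      (RefinedSobolev.toL2 : AnisoSobolev b s → Lp ℂ 2 (volume : Measure Plane)) := by
  intro h
  set k : ℝ := |s| / 2
  set P : Plane → ℂ := fun x => (((1 + ‖x‖ ^ 2) ^ k : ℝ) : ℂ) with hP
  have hPpos : ∀ x : Plane, 0 < (1 + ‖x‖ ^ 2) ^ k := fun x => by positivity
  have hPne : ∀ x, P x ≠ 0 := fun x => by
    simp only [hP]; exact_mod_cast (hPpos x).ne'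
  have hPt : P.HasTemperateGrowth := by
    have := Function.hasTemperateGrowth_one_add_norm_sq_rpow Plane k
    exact Function.Complex.hasTemperateGrowth_ofReal.comp this
  have hPc : Continuous P := hPt.1.continuous
  have hW : Measurable (fun x => (rWeight b s 1 x : ℂ)) :=
    Complex.measurable_ofReal.comp (measurable_rWeight b s 1)
  set g : Plane → ℂ := fun x => (rWeight b s 1 x : ℂ)⁻¹ * h x with hg
  have hgm : AEStronglyMeasurable g :=
    hW.inv.aestronglyMeasurable.mul (Lp.aestronglyMeasurable h)
  have hg' : MemLp (fun x => (P x)⁻¹ * g x) 2 := by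
    refine MemLp.of_le_mul (c := 2 ^ k) (Lp.memLp h)
      ((hPc.measurable.inv).aestronglyMeasurable.mul hgm) (ae_of_all _ fun x => ?_)
    have e1 : ‖(P x)⁻¹ * g x‖ = ((1 + ‖x‖ ^ 2) ^ k)⁻¹ * (rWeight b s 1 x)⁻¹ * ‖h x‖ := by
      simp only [hg, hP, norm_mul, norm_inv, Complex.norm_real, Real.norm_eq_abs,
        abs_of_pos (hPpos x), abs_of_pos (rWeight_pos b s 1 x)]
      ring
    rw [e1]
    refine mul_le_mul_of_nonneg_right ?_ (norm_nonneg _)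
    have := inv_rWeight_le b s x
    rw [inv_mul_le_iff₀ (hPpos x), mul_comm]
    exact this
  set h' : Lp ℂ 2 (volume : Measure Plane) := hg'.toLp _
  have hae : (h' : Plane → ℂ) =ᵐ[volume] fun x => (P x)⁻¹ * g x := hg'.coeFn_toLp
  set G : 𝓢'(Plane, ℂ) :=
    TemperedDistribution.smulLeftCLM ℂ P (Lp.toTemperedDistribution h') with hG
  have hGint : ∀ χ : 𝓢(Plane, ℂ), Integrable (fun ξ => χ ξ * g ξ) := fun χ => by
    have i := MemLp.integrable_mul ((SchwartzMap.smulLeftCLM ℂ P χ).memLp 2 volume) hg'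
    refine i.congr (ae_of_all _ fun ξ => ?_)
    simp only [Pi.mul_apply, SchwartzMap.smulLeftCLM_apply_apply hPt, smul_eq_mul]
    field_simp [hPne ξ]
  have hGeq : ∀ χ : 𝓢(Plane, ℂ), G χ = ∫ ξ, χ ξ * g ξ := fun χ => by
    rw [hG, TemperedDistribution.smulLeftCLM_apply_apply, Lp.toTemperedDistribution_apply]
    refine integral_congr_ae ?_
    filter_upwards [hae] with ξ hξ
    rw [hξ, SchwartzMap.smulLeftCLM_apply_apply hPt]
    simp only [smul_eq_mul]
    field_simp [hPne ξ]
  have hgloc : LocallyIntegrable g := by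
    have l : LocallyIntegrable (fun x => (P x)⁻¹ * g x) := hg'.locallyIntegrable (by norm_num)
    have := l.continuous_smul (g := P) hPc
    refine this.congr (ae_of_all _ fun x => ?_)
    simp only [smul_eq_mul]
    field_simp [hPne x]
  have hwd : IsFourierDensity (PointwiseConvergenceCLM.precomp ℂ angularFourierInv G) g := by
    refine ⟨hgloc, fun χ => ⟨hGint χ, ?_⟩⟩
    rw [← hGeq χ]
    change G (angularFourierInv (angularFourier χ)) = _
    rw [angularFourierInv_angularFourier]
  have hWne : ∀ x, (rWeight b s 1 x : ℂ) ≠ 0 := fun x => by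
    exact_mod_cast (rWeight_pos b s 1 x).ne'
  have hmem : MemLp (fun ξ => (rWeight b s 1 ξ : ℂ) * g ξ) 2 := by
    refine (Lp.memLp h).congr_norm (hW.aestronglyMeasurable.mul hgm) (ae_of_all _ fun ξ => ?_)
    simp only [hg]
    rw [mul_inv_cancel_left₀ (hWne ξ)]
  let w : AnisoSobolev b s := ⟨_, g, hwd, (memLp_rWeight_iff hgm).1 hmem⟩
  refine ⟨w, ?_⟩
  refine Lp.ext ?_
  have e : w.fourier =ᵐ[volume] g := w.isFourierDensity.ae_eq hwd
  have e2 : (RefinedSobolev.toL2 w : Plane → ℂ) =ᵐ[volume] _ := w.memLp.coeFn_toLp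
  filter_upwards [e, e2] with ξ h1 h2
  rw [h2, h1]
  simp only [hg]
  rw [mul_inv_cancel_left₀ (hWne ξ)]

instance (b : ℕ) (s : ℝ) : CompleteSpace (AnisoSobolev b s) := by
  let e : AnisoSobolev b s ≃ₗᵢ[ℂ] Lp ℂ 2 (volume : Measure Plane) :=
    LinearIsometryEquiv.ofSurjective ⟨RefinedSobolev.toL2, fun _ => rfl⟩ (toL2_surjective b s)
  exact (completeSpace_congr (e := e.toEquiv) e.isometry.isUniformEmbedding).2 inferInstance

theorem refinedSobolev_anti (b : ℕ) {s t : ℝ} (h : s ≤ t) :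
    refinedSobolev b t 1 ≤ refinedSobolev b s 1 := by
  rintro w ⟨g, hg, i⟩
  refine ⟨g, hg, i.mono' ?_ (ae_of_all _ fun ξ => ?_)⟩
  · refine AEStronglyMeasurable.mul ?_ (hg.1.aestronglyMeasurable.norm.pow 2)
    simp only [SlowParam.one_apply, one_pow, mul_one]
    exact ((continuous_rGamma b).measurable.pow_const _).aestronglyMeasurable
  · have h0 : rGamma b ξ ^ (2 * s) ≤ rGamma b ξ ^ (2 * t) :=
      Real.rpow_le_rpow_of_exponent_le (one_le_rGamma b ξ) (by linarith)
    have h1 := Real.rpow_nonneg (rGamma_pos b ξ).le (2 * s)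
    simp only [SlowParam.one_apply, one_pow, mul_one]
    rw [Real.norm_of_nonneg (by positivity)]
    gcongr

/-- The embedding `H^{t,tγ}(ℝ²) ↪ H^{s,sγ}(ℝ²)`, `s ≤ t`, which does not change the
distribution. -/
def embed (b : ℕ) {s t : ℝ} (h : s ≤ t) : AnisoSobolev b t →ₗ[ℂ] AnisoSobolev b s :=
  Submodule.inclusion (refinedSobolev_anti b h)

theorem toDist_embed (b : ℕ) {s t : ℝ} (h : s ≤ t) (w : AnisoSobolev b t) :
    RefinedSobolev.toDist (embed b h w) = RefinedSobolev.toDist w := rfl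

end AnisoSobolev

/-! ### Functions of self-adjoint operators -/

/-- A projection-valued (spectral) measure on the Borel sets of the real line. The values of `proj`
on non-Borel sets are ignored. -/
structure SpectralMeasure (X : Type*) [NormedAddCommGroup X] [InnerProductSpace ℂ X]
    [CompleteSpace X] where
  proj : Set ℝ → X →L[ℂ] X
  isStarProjection' : ∀ B, MeasurableSet B → IsStarProjection (proj B)
  proj_univ' : proj univ = 1
  proj_inter' : ∀ A B, MeasurableSet A → MeasurableSet B → proj (A ∩ B) = proj A * proj B
  hasSum_iUnion' : ∀ B : ℕ → Set ℝ, (∀ i, MeasurableSet (B i)) →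
    Pairwise (Function.onFun Disjoint B) →
      ∀ u : X, HasSum (fun i => proj (B i) u) (proj (⋃ i, B i) u)

namespace SpectralMeasure

variable {X : Type*} [NormedAddCommGroup X] [InnerProductSpace ℂ X] [CompleteSpace X]

theorem inner_proj (E : SpectralMeasure X) {B : Set ℝ} (hB : MeasurableSet B) (u : X) :
    ⟪u, E.proj B u⟫_ℂ = ((‖E.proj B u‖ ^ 2 : ℝ) : ℂ) := by
  obtain ⟨hi, hs⟩ := E.isStarProjection' B hB
  have h1 : E.proj B (E.proj B u) = E.proj B u := congrArg (fun T : X →L[ℂ] X => T u) hi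
  have h2 := ContinuousLinearMap.adjoint_inner_left (E.proj B) (E.proj B u) u
  rw [← ContinuousLinearMap.star_eq_adjoint, hs.star_eq, h1] at h2
  rw [← h2, inner_self_eq_norm_sq_to_K]
  norm_cast

theorem proj_empty (E : SpectralMeasure X) : E.proj ∅ = 0 := by
  ext u
  have h := E.hasSum_iUnion' (fun _ => ∅) (fun _ => .empty) (fun _ _ _ => by simp) u
  simpa using (summable_const_iff _).1 h.summable

/-- The scalar measure `B ↦ (E(B)u, u) = ‖E(B)u‖²`. -/
def scalar (E : SpectralMeasure X) (u : X) : Measure ℝ :=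
  Measure.ofMeasurable (fun B _ => ENNReal.ofReal (‖E.proj B u‖ ^ 2))
    (by simp [E.proj_empty])
    (by
      intro B hB hd
      have h := (E.hasSum_iUnion' B hB hd u).mapL (innerSL ℂ u)
      simp only [innerSL_apply_apply, E.inner_proj (hB _), E.inner_proj (.iUnion hB)] at h
      have h' : HasSum (fun i => ‖E.proj (B i) u‖ ^ 2) (‖E.proj (⋃ i, B i) u‖ ^ 2) :=
        Complex.hasSum_ofReal.1 h
      rw [← h'.tsum_eq, ENNReal.ofReal_tsum_of_nonneg (fun _ => by positivity) h'.summable])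

theorem scalar_apply (E : SpectralMeasure X) (u : X) {B : Set ℝ} (hB : MeasurableSet B) :
    E.scalar u B = ENNReal.ofReal (‖E.proj B u‖ ^ 2) :=
  Measure.ofMeasurable_apply B hB

/-- `T = ∫ f(λ) dE(λ)`: the domain of `T` consists of all `u` with `∫ f² d(Eu,u) < ∞`, and
`(Tu,u) = ∫ f d(Eu,u)` for these `u` (which determines `T` by polarization). -/
structure IsIntegral (E : SpectralMeasure X) (f : ℝ → ℝ) (T : X →ₗ.[ℂ] X) : Prop where
  mem_domain_iff : ∀ u : X,
    u ∈ T.domain ↔ ∫⁻ t, ENNReal.ofReal (f t ^ 2) ∂(E.scalar u) < ⊤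
  inner_apply : ∀ u : T.domain, ⟪(u : X), T u⟫_ℂ = ((∫ t, f t ∂(E.scalar u) : ℝ) : ℂ)

end SpectralMeasure

/-- `T = f(J)`, the Borel function `f` of the self-adjoint operator `J`: if `J = ∫ λ dE(λ)` is the
spectral resolution of `J`, then `T = ∫ f(λ) dE(λ)`. -/
def IsBorelFunctionOf {X : Type*} [NormedAddCommGroup X] [InnerProductSpace ℂ X] [CompleteSpace X]
    (f : ℝ → ℝ) (J T : X →ₗ.[ℂ] X) : Prop :=
  ∃ E : SpectralMeasure X, E.IsIntegral (fun t => t) J ∧ E.IsIntegral f T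

/-! ### Interpolation with a function parameter -/

/-- The couple `[X₀, X₁]`, with `X₁` embedded into `X₀` by `ι`, is admissible: both are separable
Hilbert spaces, and the embedding is continuous and dense. -/
structure IsAdmissibleCouple {X₀ X₁ : Type*} [NormedAddCommGroup X₀] [InnerProductSpace ℂ X₀]
    [NormedAddCommGroup X₁] [InnerProductSpace ℂ X₁] (ι : X₁ →ₗ[ℂ] X₀) : Prop where
  complete₀ : CompleteSpace X₀
  complete₁ : CompleteSpace X₁
  separable₀ : TopologicalSpace.SeparableSpace X₀
  separable₁ : TopologicalSpace.SeparableSpace X₁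
  injective : Function.Injective ι
  continuous : Continuous ι
  dense : DenseRange ι

/-- `J` is the generating operator of the couple `[X₀, X₁]`: a positive self-adjoint operator on
`X₀` with domain `X₁` that is an isometric isomorphism of `X₁` onto `X₀`. -/
structure IsGeneratingOperator {X₀ X₁ : Type*} [NormedAddCommGroup X₀] [InnerProductSpace ℂ X₀]
    [CompleteSpace X₀] [NormedAddCommGroup X₁] [InnerProductSpace ℂ X₁]
    (ι : X₁ →ₗ[ℂ] X₀) (J : X₀ →ₗ.[ℂ] X₀) : Prop where
  domain_eq : J.domain = LinearMap.range ι
  isometricIso : ∃ V : X₁ ≃ₗᵢ[ℂ] X₀, ∀ (v : X₁) (u : J.domain), (u : X₀) = ι v → J u = V v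
  selfAdjoint : IsSelfAdjoint J
  positive : ∀ u : J.domain, (u : X₀) ≠ 0 → 0 < (⟪(u : X₀), J u⟫_ℂ).re

/-- The class `𝓑` of Borel functions `ψ : (0,∞) → (0,∞)` such that `ψ` is bounded on every compact
`[a,c] ⊂ (0,∞)` and `1/ψ` is bounded on every `[a,∞)`, `a > 0`. -/
structure IsClassB (ψ : ℝ → ℝ) : Prop where
  measurable : Measurable fun r : Ioi (0 : ℝ) => ψ r
  pos : ∀ r, 0 < r → 0 < ψ r
  bounded : ∀ a c, 0 < a → a < c → ∃ C, ∀ r ∈ Icc a c, ψ r ≤ C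
  inv_bounded : ∀ a, 0 < a → ∃ C, ∀ r, a ≤ r → (ψ r)⁻¹ ≤ C

/-- The interpolation parameter
`ψ(r) = r^{(s-s₀)/(s₁-s₀)} φ(r^{1/(s₁-s₀)})` for `r ≥ 1` and `ψ(r) = φ(1)` for `0 < r < 1`
(the values for `r ≤ 0` play no role, as it is applied to positive operators only). -/
def interpParam (s₀ s s₁ : ℝ) (φ : SlowParam) (r : ℝ) : ℝ :=
  if 1 ≤ r then r ^ ((s - s₀) / (s₁ - s₀)) * φ (r ^ (1 / (s₁ - s₀))) else φ 1

end

/-! On the Fourier side everything is multiplication. The map `w ↦ r_γ^{s₀} ŵ` identifies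
`H^{s₀,s₀γ}` with `L₂`, and under it multiplication by `r_γ^{s₁-s₀}` has maximal domain `H^{s₁,s₁γ}`
and is an isometry of that space onto `H^{s₀,s₀γ}`. This operator is therefore the generating
operator `J`. Since `r_γ ≥ 1`, the function `ψ` is made so that `ψ(r_γ^{s₁-s₀}) = r_γ^{s-s₀}
φ(r_γ)`. Hence `ψ(J)` is multiplication by this symbol, its domain is `H^{s,sγ,φ}`, and `‖ψ(J)u‖` is
the norm of that space.

Three points need real arguments.

Slow variation: `φ(r) ≥ c r^{-ε}` for every `ε > 0` (`SlowParam.exists_rpow_neg_le`). This follows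
from uniform convergence on compact sets in Karamata's theory. With `ε = s - s₀` it gives both the
bound on `1/ψ` and the inclusion of `H^{s,sγ,φ}` in `H^{s₀,s₀γ}`.

Uniqueness of `J`: the inverse of a generating operator is the positive square root of `ι ι*`, which
depends on the couple only.

Uniqueness of `ψ(J)`: an operator `∫ f dE` depends only on `f` and the scalar measures of `E`
(`IsIntegral.unique`). Two spectral resolutions `E`, `F` of `J` have equal scalar measures
(`IsIntegral.scalar_eq`), because the range of `E(-∞,a]` is orthogonal to that of `F[b,∞)` for `a <
b`: moving powers of `J` across the inner product gains a factor `a/b` each time. -/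

/-! ### Slowly varying functions -/

/-- If `h` is measurable and `h (x + u) - h x → 0` as `x → ∞` for every `u`, then the convergence is
uniform in `u ∈ [0,1]`. -/
theorem eventually_forall_abs_sub_lt_of_tendsto_sub {h : ℝ → ℝ} (hm : Measurable h)
    (hl : ∀ u, Tendsto (fun x => h (x + u) - h x) atTop (𝓝 0)) {ε : ℝ} (hε : 0 < ε) :
    ∀ᶠ x in atTop, ∀ u ∈ Icc (0 : ℝ) 1, |h (x + u) - h x| < ε := by
  -- The interval has length 2, although `u ≤ 1`, so that `[u,2]` always has length at least 1.
  set bad : ℝ → Set ℝ := fun x => {y ∈ Icc (0 : ℝ) 2 | ε / 2 ≤ |h (x + y) - h x|} with hbad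
  have hbm : ∀ x, MeasurableSet (bad x) := fun x =>
    measurableSet_Icc.inter (measurableSet_le measurable_const
      (((hm.comp (measurable_const_add x)).sub_const _).abs))
  have hlim : Tendsto (fun x => volume (bad x)) atTop (𝓝 (volume (∅ : Set ℝ))) := by
    refine tendsto_measure_of_ae_tendsto_indicator atTop (B := Icc 0 2) (A := ∅)
      MeasurableSet.empty hbm measurableSet_Icc
      (by simp) (Eventually.of_forall fun x y hy => hy.1) (ae_of_all _ fun y => ?_)
    have := (hl y).abs
    rw [abs_zero] at this
    filter_upwards [this.eventually (gt_mem_nhds (half_pos hε))] with x hx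
    simp only [hbad, mem_ofPred_eq, mem_empty_iff_false, iff_false, not_and, not_le]
    exact fun _ => hx
  rw [measure_empty] at hlim
  have hsmall : ∀ᶠ x in atTop, volume (bad x) < ENNReal.ofReal (1 / 2) :=
    hlim.eventually (gt_mem_nhds (by simp))
  obtain ⟨M, hM⟩ := eventually_atTop.1 hsmall
  filter_upwards [eventually_ge_atTop M] with x hx u hu
  -- Each of the two exceptional sets has measure below 1/2, so some `y ∈ [u,2]` avoids both. Then
  -- `h (x + y)` is within `ε / 2` of both `h x` and `h (x + u)`.
  have hnot : ¬ Icc u 2 ⊆ bad x ∪ (fun y => -u + y) ⁻¹' bad (x + u) := by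
    intro hsub
    have h1 := (measure_mono hsub).trans (measure_union_le (μ := volume) _ _)
    rw [measure_preimage_add, Real.volume_Icc] at h1
    have h2 := ENNReal.add_lt_add (hM x hx) (hM (x + u) (by linarith [hu.1]))
    rw [← ENNReal.ofReal_add (by norm_num) (by norm_num)] at h2
    have h3 := (ENNReal.ofReal_lt_ofReal_iff (by norm_num)).1 (h1.trans_lt h2)
    linarith [hu.2]
  obtain ⟨y, hy, hyn⟩ := not_subset.1 hnot
  simp only [hbad, mem_union, mem_preimage, mem_ofPred_eq, not_or, not_and, not_le, mem_Icc] at hyn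
  have a1 := hyn.1 ⟨by linarith [hu.1, hy.1], hy.2⟩
  have a2 := hyn.2 ⟨by linarith [hy.1], by linarith [hu.1, hy.2]⟩
  rw [show x + u + (-u + y) = x + y by ring] at a2
  rw [abs_lt] at a1 a2 ⊢
  constructor <;> linarith [a1.1, a1.2, a2.1, a2.2]

/-- A measurable function that is bounded below on bounded intervals and whose increments tend
to zero at infinity decreases more slowly than any linear function. -/
theorem exists_forall_neg_mul_le_of_tendsto_sub {h : ℝ → ℝ} (hm : Measurable h)
    (hl : ∀ u, Tendsto (fun x => h (x + u) - h x) atTop (𝓝 0))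
    (hb : ∀ M, ∃ C, ∀ x ∈ Icc (0 : ℝ) M, -C ≤ h x) {ε : ℝ} (hε : 0 < ε) :
    ∃ C, ∀ x, 0 ≤ x → -C - ε * x ≤ h x := by
  obtain ⟨M, hM⟩ := eventually_atTop.1 (eventually_forall_abs_sub_lt_of_tendsto_sub hm hl hε)
  obtain ⟨C, hC⟩ := hb (max M 0 + 1)
  refine ⟨C, fun x hx => ?_⟩
  -- Beyond `max M 0 + 1`, stepping back by 1 costs less than `ε`, which is exactly the slack that
  -- `-ε * x` gains.
  have key : ∀ n : ℕ, ∀ x, 0 ≤ x → x ≤ max M 0 + 1 + n → -C - ε * x ≤ h x := by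
    intro n
    induction n with
    | zero =>
      intro x hx hx'
      have := hC x ⟨hx, by simpa using hx'⟩
      nlinarith
    | succ n ih =>
      intro x hx hx'
      rcases le_or_gt x (max M 0 + 1) with h1 | h1
      · have := hC x ⟨hx, h1⟩
        nlinarith
      · have h2 := ih (x - 1) (by linarith [le_max_right M 0]) (by push_cast at hx'; linarith)
        have h3 := hM (x - 1) (by linarith [le_max_left M 0]) 1 ⟨zero_le_one, le_rfl⟩
        rw [sub_add_cancel, abs_lt] at h3
        nlinarith [h3.1]
  obtain ⟨n, hn⟩ := exists_nat_ge x
  exact key n x hx (by linarith [le_max_right M 0])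

theorem SlowParam.measurable_comp (φ : SlowParam) {α : Type*} [MeasurableSpace α] {f : α → ℝ}
    (hf : Measurable f) (h1 : ∀ x, 1 ≤ f x) : Measurable fun x => φ (f x) :=
  φ.measurable'.comp (hf.subtype_mk (h := h1))

/-- A slowly varying function decreases more slowly than any negative power. -/
theorem SlowParam.exists_rpow_neg_le (φ : SlowParam) {ε : ℝ} (hε : 0 < ε) :
    ∃ c, 0 < c ∧ ∀ r, 1 ≤ r → c * r ^ (-ε) ≤ φ r := by
  -- In logarithmic coordinates slow variation says that increments tend to zero, and a power bound
  -- becomes a linear one. The `max` keeps the argument of `φ` in `[1,∞)`, outside of which nothing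
  -- is known about `φ`.
  set h : ℝ → ℝ := fun x => Real.log (φ (Real.exp (max x 0))) with hh
  have hexp : ∀ x : ℝ, 1 ≤ Real.exp (max x 0) := fun x => Real.one_le_exp (le_max_right _ _)
  have hm : Measurable h :=
    (φ.measurable_comp (Real.measurable_exp.comp (measurable_id.max measurable_const))
      hexp).log
  have hl : ∀ u, Tendsto (fun x => h (x + u) - h x) atTop (𝓝 0) := by
    intro u
    have h1 := (φ.slow' (Real.exp u) (Real.exp_pos u)).comp Real.tendsto_exp_atTop
    have h2 := (Real.continuousAt_log one_ne_zero).tendsto.comp h1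
    rw [Real.log_one] at h2
    refine h2.congr' ?_
    filter_upwards [eventually_ge_atTop 0, eventually_ge_atTop (-u)] with x hx hxu
    have e1 : max x 0 = x := max_eq_left hx
    have e2 : max (x + u) 0 = x + u := max_eq_left (by linarith)
    simp only [hh, Function.comp_apply, e1, e2]
    rw [← Real.exp_add, add_comm u x, Real.log_div]
    · exact (φ.pos' _ (Real.one_le_exp (by linarith))).ne'
    · exact (φ.pos' _ (Real.one_le_exp hx)).ne'
  have hb : ∀ M, ∃ C, ∀ x ∈ Icc (0 : ℝ) M, -C ≤ h x := by
    intro M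
    obtain ⟨C, hC⟩ := φ.bounded' (Real.exp (max M 1))
      (Real.one_lt_exp_iff.2 (by linarith [le_max_right M 1]))
    refine ⟨Real.log C, fun x hx => ?_⟩
    have e1 : max x 0 = x := max_eq_left hx.1
    have h1 := (hC (Real.exp x) ⟨Real.one_le_exp hx.1,
      Real.exp_le_exp.2 (hx.2.trans (le_max_left _ _))⟩).2
    have h0 := φ.pos' _ (Real.one_le_exp hx.1)
    have h2 := Real.log_le_log (inv_pos.2 h0) h1
    rw [Real.log_inv] at h2
    simp only [hh, e1]
    linarith
  obtain ⟨C, hC⟩ := exists_forall_neg_mul_le_of_tendsto_sub hm hl hb hε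
  refine ⟨Real.exp (-C), Real.exp_pos _, fun r hr => ?_⟩
  have hr0 : 0 < r := by linarith
  have h1 := hC (Real.log r) (Real.log_nonneg hr)
  have e1 : max (Real.log r) 0 = Real.log r := max_eq_left (Real.log_nonneg hr)
  simp only [hh, e1, Real.exp_log hr0] at h1
  rw [Real.rpow_def_of_pos hr0, ← Real.exp_add, ← Real.le_log_iff_exp_le (φ.pos' r hr)]
  linarith

/-! ### The interpolation parameter `ψ` -/

theorem one_le_rpow_one_div {r t : ℝ} (hr : 1 ≤ r) (ht : 0 < t) : 1 ≤ r ^ (1 / t) :=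
  Real.one_le_rpow hr (by positivity)

theorem measurable_interpParam (s₀ s s₁ : ℝ) (φ : SlowParam) (h : s₀ < s₁) :
    Measurable (interpParam s₀ s s₁ φ) := by
  have hm : Measurable fun r : ℝ => φ ((max r 1) ^ (1 / (s₁ - s₀))) :=
    φ.measurable_comp ((measurable_id.max measurable_const).pow_const _)
      fun r => one_le_rpow_one_div (le_max_right _ _) (sub_pos.2 h)
  have e : interpParam s₀ s s₁ φ = fun r => if 1 ≤ r then
      r ^ ((s - s₀) / (s₁ - s₀)) * φ ((max r 1) ^ (1 / (s₁ - s₀))) else φ 1 := by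
    ext r
    unfold interpParam
    split_ifs with hr
    · rw [max_eq_left hr]
    · rfl
  rw [e]
  exact Measurable.ite measurableSet_Ici ((measurable_id.pow_const _).mul hm) measurable_const

theorem interpParam_pos (s₀ s s₁ : ℝ) (φ : SlowParam) (h : s₀ < s₁) (r : ℝ) :
    0 < interpParam s₀ s s₁ φ r := by
  unfold interpParam
  split_ifs with hr
  · exact mul_pos (Real.rpow_pos_of_pos (by linarith) _)
      (φ.pos' _ (one_le_rpow_one_div hr (sub_pos.2 h)))
  · exact φ.pos' 1 le_rfl

theorem isClassB_interpParam {s₀ s s₁ : ℝ} (φ : SlowParam) (h₀ : s₀ < s) (h₁ : s < s₁) :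
    IsClassB (interpParam s₀ s s₁ φ) where
  measurable := (measurable_interpParam s₀ s s₁ φ (h₀.trans h₁)).comp measurable_subtype_coe
  pos r _ := interpParam_pos s₀ s s₁ φ (h₀.trans h₁) r
  bounded a c _ _ := by
    have hd : 0 < s₁ - s₀ := by linarith
    -- `max c 2` makes the right endpoint exceed 1, since `c` itself may be less than 1.
    obtain ⟨C, hC⟩ := φ.bounded' ((max c 2) ^ (1 / (s₁ - s₀)))
      (Real.one_lt_rpow (by linarith [le_max_right c 2]) (by positivity))
    refine ⟨max ((max c 2) ^ ((s - s₀) / (s₁ - s₀)) * C) (φ 1), fun r hr => ?_⟩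
    unfold interpParam
    split_ifs with h1
    · refine le_max_of_le_left ?_
      have hrc : r ≤ max c 2 := hr.2.trans (le_max_left _ _)
      have h2 : 1 ≤ r ^ (1 / (s₁ - s₀)) := one_le_rpow_one_div h1 hd
      have h3 := (hC (r ^ (1 / (s₁ - s₀)))
        ⟨h2, Real.rpow_le_rpow (by linarith) hrc (by positivity)⟩).1
      have h4 := (φ.pos' _ h2).le
      have h5 : 0 ≤ (s - s₀) / (s₁ - s₀) := div_nonneg (by linarith) hd.le
      have h6 : 0 ≤ r := by linarith
      gcongr
    · exact le_max_right _ _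
  inv_bounded a _ := by
    have hd : 0 < s₁ - s₀ := by linarith
    -- The exponent `s - s₀` is chosen so that, at `r^{1/(s₁-s₀)}`, the lower bound for `φ` cancels
    -- the power in `ψ` exactly.
    obtain ⟨c, hc, hle⟩ := φ.exists_rpow_neg_le (sub_pos.2 h₀)
    refine ⟨max c⁻¹ (φ 1)⁻¹, fun r _ => ?_⟩
    unfold interpParam
    split_ifs with h1
    · refine le_max_of_le_left (inv_anti₀ hc ?_)
      have h2 := hle _ (one_le_rpow_one_div h1 hd)
      have hr0 : 0 < r := by linarith
      have h3 : 0 < r ^ ((s - s₀) / (s₁ - s₀)) := Real.rpow_pos_of_pos hr0 _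
      rw [← Real.rpow_mul hr0.le,
        show 1 / (s₁ - s₀) * -(s - s₀) = -((s - s₀) / (s₁ - s₀)) by ring,
        Real.rpow_neg hr0.le] at h2
      calc c = r ^ ((s - s₀) / (s₁ - s₀)) * (c * (r ^ ((s - s₀) / (s₁ - s₀)))⁻¹) := by
            field_simp
        _ ≤ _ := by gcongr
    · exact le_max_right _ _

/-- Evaluates `ψ` on the symbol of `J`; this identity is what dictates the form of `ψ`. -/
theorem interpParam_rpow {s₀ s s₁ : ℝ} (φ : SlowParam) (h : s₀ < s₁) {r : ℝ} (hr : 1 ≤ r) :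
    interpParam s₀ s s₁ φ (r ^ (s₁ - s₀)) = r ^ (s - s₀) * φ r := by
  have hd : 0 < s₁ - s₀ := by linarith
  have hr0 : 0 ≤ r := by linarith
  rw [interpParam, if_pos (Real.one_le_rpow hr hd.le), ← Real.rpow_mul hr0, ← Real.rpow_mul hr0,
    mul_div_cancel₀ _ hd.ne', mul_one_div_cancel hd.ne', Real.rpow_one]

/-! ### Spectral measures -/

namespace SpectralMeasure

variable {X : Type*} [NormedAddCommGroup X] [InnerProductSpace ℂ X] [CompleteSpace X]
variable (E : SpectralMeasure X)

theorem proj_proj {A B : Set ℝ} (hA : MeasurableSet A) (hB : MeasurableSet B) (u : X) :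
    E.proj A (E.proj B u) = E.proj (A ∩ B) u := by
  rw [E.proj_inter' A B hA hB]; rfl

theorem proj_idem {B : Set ℝ} (hB : MeasurableSet B) (u : X) :
    E.proj B (E.proj B u) = E.proj B u := by
  rw [E.proj_proj hB hB, inter_self]

theorem inner_proj_left {B : Set ℝ} (hB : MeasurableSet B) (u v : X) :
    ⟪E.proj B u, v⟫_ℂ = ⟪u, E.proj B v⟫_ℂ := by
  have h := ContinuousLinearMap.adjoint_inner_left (E.proj B) v u
  rwa [← ContinuousLinearMap.star_eq_adjoint, (E.isStarProjection' B hB).2.star_eq] at h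

theorem scalar_univ (u : X) : E.scalar u univ = ENNReal.ofReal (‖u‖ ^ 2) := by
  rw [E.scalar_apply u .univ, E.proj_univ']; rfl

instance (u : X) : IsFiniteMeasure (E.scalar u) :=
  ⟨by rw [E.scalar_univ]; exact ENNReal.ofReal_lt_top⟩

theorem proj_eq_zero_iff {B : Set ℝ} (hB : MeasurableSet B) (u : X) :
    E.proj B u = 0 ↔ E.scalar u B = 0 := by
  rw [E.scalar_apply u hB, ENNReal.ofReal_eq_zero]
  constructor
  · intro h; simp [h]
  · intro h
    have : ‖E.proj B u‖ ^ 2 = 0 := le_antisymm h (by positivity)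
    simpa using this

/-- The defect `v = u - E(B)u - E(Bᶜ)u` is killed by both projections, so its scalar measure, of
total mass `‖v‖²`, vanishes on `B` and on `Bᶜ`. -/
theorem proj_compl {B : Set ℝ} (hB : MeasurableSet B) (u : X) :
    E.proj Bᶜ u = u - E.proj B u := by
  have h1 : E.proj B (E.proj Bᶜ u) = 0 := by
    rw [E.proj_proj hB hB.compl, inter_compl_self, E.proj_empty]; rfl
  have h2 : E.proj Bᶜ (u - E.proj B u - E.proj Bᶜ u) = 0 := by
    rw [map_sub, map_sub, E.proj_idem hB.compl, E.proj_proj hB.compl hB, compl_inter_self,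
      E.proj_empty]
    simp
  have h3 : E.proj B (u - E.proj B u - E.proj Bᶜ u) = 0 := by
    rw [map_sub, map_sub, E.proj_idem hB, h1]
    simp
  have h4 : u - E.proj B u - E.proj Bᶜ u = 0 := by
    set v := u - E.proj B u - E.proj Bᶜ u
    rw [proj_eq_zero_iff E hB] at h3
    rw [proj_eq_zero_iff E hB.compl] at h2
    have : E.scalar v univ = 0 := by rw [← measure_add_measure_compl hB, h2, h3, add_zero]
    rw [← proj_eq_zero_iff E .univ, E.proj_univ'] at this
    exact this
  exact (sub_eq_zero.1 h4).symm

theorem scalar_proj {B : Set ℝ} (hB : MeasurableSet B) (u : X) :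
    E.scalar (E.proj B u) = (E.scalar u).restrict B := by
  ext S hS
  rw [Measure.restrict_apply hS, E.scalar_apply _ hS, E.scalar_apply _ (hS.inter hB),
    E.proj_proj hS hB]

theorem proj_eq_self_of_subset {A B : Set ℝ} (hA : MeasurableSet A) (hB : MeasurableSet B)
    (h : A ⊆ B) {u : X} (hu : E.proj A u = u) : E.proj B u = u := by
  rw [← hu, E.proj_proj hB hA, inter_eq_self_of_subset_right h]

/-- Scalar measures are additive on pairs of vectors that are separated by a spectral
projection. -/
theorem scalar_add {B : Set ℝ} (hB : MeasurableSet B) {u v : X} (hu : E.proj B u = u)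
    (hv : E.proj B v = 0) : E.scalar (u + v) = E.scalar u + E.scalar v := by
  ext S hS
  rw [Measure.add_apply, E.scalar_apply _ hS, E.scalar_apply _ hS, E.scalar_apply _ hS,
    ← ENNReal.ofReal_add (by positivity) (by positivity)]
  congr 1
  have h : ⟪E.proj S u, E.proj S v⟫_ℂ = 0 := by
    rw [← hu, E.proj_proj hS hB, inter_comm, ← E.proj_proj hB hS, E.inner_proj_left hB,
      E.proj_proj hB hS, inter_comm, ← E.proj_proj hS hB, hv]
    simp
  rw [map_add, sq, sq, sq, norm_add_sq_eq_norm_sq_add_norm_sq_of_inner_eq_zero _ _ h]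

theorem scalar_ext_of_proj {E F : SpectralMeasure X}
    (h : ∀ a : ℝ, E.proj (Iic a) = F.proj (Iic a)) (u : X) : E.scalar u = F.scalar u := by
  refine Measure.ext_of_Iic _ _ fun a => ?_
  rw [E.scalar_apply u measurableSet_Iic, F.scalar_apply u measurableSet_Iic, h]

/-! ### Operators `∫ f dE` -/

namespace IsIntegral

variable {E} {f : ℝ → ℝ} {T : X →ₗ.[ℂ] X}

theorem proj_mem (hT : E.IsIntegral f T) {B : Set ℝ} (hB : MeasurableSet B) {u : X}
    (hu : u ∈ T.domain) : E.proj B u ∈ T.domain := by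
  rw [hT.mem_domain_iff] at hu ⊢
  rw [E.scalar_proj hB]
  exact (lintegral_mono' Measure.restrict_le_self le_rfl).trans_lt hu

theorem mem_of_bounded (hT : E.IsIntegral f T) {B : Set ℝ} (hB : MeasurableSet B) {C : ℝ}
    (hC : ∀ t ∈ B, |f t| ≤ C) (u : X) : E.proj B u ∈ T.domain := by
  rw [hT.mem_domain_iff, E.scalar_proj hB]
  refine (setLIntegral_mono (g := fun _ => ENNReal.ofReal (C ^ 2)) measurable_const
    fun t ht => ENNReal.ofReal_le_ofReal (sq_le_sq' ?_ ?_)).trans_lt ?_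
  · linarith [neg_abs_le (f t), hC t ht]
  · exact (le_abs_self _).trans (hC t ht)
  · rw [setLIntegral_const]
    exact ENNReal.mul_lt_top ENNReal.ofReal_lt_top (measure_lt_top _ _)

/-- Cutting the line along the integer part of `|f|` writes `u` as a convergent sum of pieces on
which `f` is bounded, and these pieces lie in the domain. -/
theorem dense_domain (hT : E.IsIntegral f T) (hf : Measurable f) :
    Dense (T.domain : Set X) := by
  intro u
  set B : ℕ → Set ℝ := fun n => {t | ⌊|f t|⌋₊ = n} with hBdef
  have hB : ∀ n, MeasurableSet (B n) := fun n =>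
    (Nat.measurable_floor.comp hf.abs) (measurableSet_singleton n)
  have hd : Pairwise (Function.onFun Disjoint B) := fun i j hij =>
    Set.disjoint_left.2 fun t (h1 : _ = i) (h2 : _ = j) => hij (h1.symm.trans h2)
  have hU : ⋃ n, B n = univ := by
    ext t; simp [hBdef]
  have hs := E.hasSum_iUnion' B hB hd u
  rw [hU, E.proj_univ'] at hs
  refine mem_closure_of_tendsto hs (Eventually.of_forall fun s => ?_)
  refine T.domain.sum_mem fun n _ => hT.mem_of_bounded (hB n) (C := n + 1) (fun t ht => ?_) u
  have h1 : ⌊|f t|⌋₊ = n := ht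
  rw [← h1]
  exact (Nat.lt_floor_add_one _).le

theorem integrable (hT : E.IsIntegral f T) (hf : Measurable f) {u : X} (hu : u ∈ T.domain) :
    Integrable f (E.scalar u) := by
  have h := (hT.mem_domain_iff u).1 hu
  have h2 : MemLp f 2 (E.scalar u) := by
    rw [memLp_two_iff_integrable_sq hf.aestronglyMeasurable]
    refine ⟨(hf.pow_const 2).aestronglyMeasurable, ?_⟩
    rw [hasFiniteIntegral_iff_ofReal (ae_of_all _ fun t => sq_nonneg _)]
    exact h
  exact h2.integrable one_le_two

/-- Only the quadratic form of `T` is given. Scalar measures add for the separated pair `u`, `w`, so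
the cross terms of the form at `u + w` sum to zero. Taking `w = v` and `w = i v` kills each of them.
-/
theorem inner_eq_zero (hT : E.IsIntegral f T) (hf : Measurable f) {B : Set ℝ}
    (hB : MeasurableSet B) (u v : T.domain) (hu : E.proj B (u : X) = u)
    (hv : E.proj B (v : X) = 0) :
    ⟪(u : X), T v⟫_ℂ = 0 ∧ ⟪(v : X), T u⟫_ℂ = 0 := by
  have key : ∀ w : T.domain, E.proj B (w : X) = 0 → ⟪(u : X), T w⟫_ℂ + ⟪(w : X), T u⟫_ℂ = 0 := by
    intro w hw
    have h := hT.inner_apply (u + w)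
    have e : ((u + w : T.domain) : X) = u + w := rfl
    rw [e, E.scalar_add hB hu hw, integral_add_measure (hT.integrable hf u.2)
      (hT.integrable hf w.2), Complex.ofReal_add, ← hT.inner_apply, ← hT.inner_apply, T.map_add,
      inner_add_left, inner_add_right, inner_add_right] at h
    linear_combination h
  have h1 := key v hv
  have h2 := key (Complex.I • v) (by
    change E.proj B (Complex.I • (v : X)) = 0
    rw [map_smul, hv, smul_zero])
  have e : ((Complex.I • v : T.domain) : X) = Complex.I • (v : X) := rfl
  rw [e, T.map_smul, inner_smul_left, inner_smul_right, Complex.conj_I] at h2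
  have h3 : ⟪(u : X), T v⟫_ℂ = ⟪(v : X), T u⟫_ℂ := by
    have : Complex.I * (⟪(u : X), T v⟫_ℂ - ⟪(v : X), T u⟫_ℂ) = 0 := by linear_combination h2
    exact sub_eq_zero.1 ((mul_eq_zero.1 this).resolve_left Complex.I_ne_zero)
  rw [h3] at h1 ⊢
  have h4 : ⟪(v : X), T u⟫_ℂ = 0 := by linear_combination h1 / 2
  exact ⟨h4, h4⟩

/-- An operator commutes with its spectral projections. -/
theorem proj_apply (hT : E.IsIntegral f T) (hf : Measurable f) {B : Set ℝ}
    (hB : MeasurableSet B) (u : T.domain) :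
    E.proj B (T u) = T ⟨E.proj B u, hT.proj_mem hB u.2⟩ := by
  set p : T.domain := ⟨E.proj B u, hT.proj_mem hB u.2⟩ with hp
  have hpB : E.proj B (p : X) = p := E.proj_idem hB _
  have hqB : E.proj B ((u - p : T.domain) : X) = 0 := by
    change E.proj B ((u : X) - E.proj B u) = 0
    rw [map_sub, E.proj_idem hB, sub_self]
  have hd := hT.dense_domain hf
  -- `T p` is orthogonal to `x - E(B)x` for all `x` in the dense domain; likewise, below, `T (u -
  -- p)` is orthogonal to every `E(B)x`.
  have h1 : E.proj B (T p) = T p := by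
    refine hd.eq_of_inner_right ℂ fun x hx => ?_
    have hx' : E.proj B ((⟨x, hx⟩ - ⟨E.proj B x, hT.proj_mem hB hx⟩ : T.domain) : X) = 0 := by
      change E.proj B (x - E.proj B x) = 0
      rw [map_sub, E.proj_idem hB, sub_self]
    have h := (hT.inner_eq_zero hf hB p _ hpB hx').2
    change ⟪x - E.proj B x, T p⟫_ℂ = 0 at h
    rw [inner_sub_left, E.inner_proj_left hB, sub_eq_zero] at h
    exact h.symm
  have h2 : E.proj B (T (u - p)) = 0 := by
    refine hd.eq_of_inner_right ℂ fun x hx => ?_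
    have h := (hT.inner_eq_zero hf hB ⟨E.proj B x, hT.proj_mem hB hx⟩ _ (E.proj_idem hB x) hqB).1
    change ⟪E.proj B x, T (u - p)⟫_ℂ = 0 at h
    rw [← E.inner_proj_left hB, h, inner_zero_right]
  have h3 : T u = T p + T (u - p) := by rw [← T.map_add, add_sub_cancel]
  rw [h3, map_add, h1, h2, add_zero]

/-- The operator `∫ f dE` is determined by `f` and the scalar measures of `E`. -/
theorem unique {F : SpectralMeasure X} {S : X →ₗ.[ℂ] X} (hT : E.IsIntegral f T)
    (hS : F.IsIntegral f S) (hf : Measurable f) (h : ∀ u, E.scalar u = F.scalar u) : T = S := by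
  have hdom : T.domain = S.domain := by
    ext u; rw [hT.mem_domain_iff, hS.mem_domain_iff, h]
  refine LinearPMap.ext hdom fun u hu hu' => ?_
  have q : ∀ (x : X) (h1 : x ∈ T.domain) (h2 : x ∈ S.domain),
      ⟪x, T ⟨x, h1⟩ - S ⟨x, h2⟩⟫_ℂ = 0 := by
    intro x h1 h2
    rw [inner_sub_right, hT.inner_apply ⟨x, h1⟩, hS.inner_apply ⟨x, h2⟩, h, sub_self]
  set D : T.domain →ₗ[ℂ] X := T.toFun - S.toFun ∘ₗ Submodule.inclusion hdom.le with hD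
  have hq : ∀ x : T.domain, ⟪(x : X), D x⟫_ℂ = 0 := fun x => q x x.2 (hdom.le x.2)
  have hz : D ⟨u, hu⟩ = 0 := by
    refine (hT.dense_domain hf).eq_of_inner_right ℂ fun x hx => ?_
    rw [inner_zero_right]
    -- Complex polarization: the difference `D` of the operators has zero quadratic form, and the
    -- pairs `(x, u)` and `(x, i u)` together give `⟪x, D u⟫ = 0` on a dense set of `x`.
    have key : ∀ a b : T.domain, ⟪(a : X), D b⟫_ℂ + ⟪(b : X), D a⟫_ℂ = 0 := by
      intro a b
      have h := hq (a + b)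
      have e : ((a + b : T.domain) : X) = a + b := rfl
      rw [e, map_add, inner_add_left, inner_add_right, inner_add_right, hq, hq] at h
      linear_combination h
    have h1 := key ⟨x, hx⟩ ⟨u, hu⟩
    have h2 := key ⟨x, hx⟩ (Complex.I • ⟨u, hu⟩)
    have e : ((Complex.I • (⟨u, hu⟩ : T.domain) : T.domain) : X) = Complex.I • u := rfl
    rw [e, map_smul, inner_smul_left, inner_smul_right, Complex.conj_I] at h2
    have h3 : Complex.I * (⟪x, D ⟨u, hu⟩⟫_ℂ - ⟪u, D ⟨x, hx⟩⟫_ℂ) = 0 := by linear_combination h2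
    have h4 := (mul_eq_zero.1 h3).resolve_left Complex.I_ne_zero
    linear_combination (h1 + h4) / 2
  exact sub_eq_zero.1 hz

theorem re_inner_le (hT : E.IsIntegral (fun t => t) T) {a : ℝ} (u : T.domain)
    (hu : E.proj (Iic a) (u : X) = u) : (⟪(u : X), T u⟫_ℂ).re ≤ a * ‖(u : X)‖ ^ 2 := by
  have hi := hT.integrable measurable_id u.2
  rw [hT.inner_apply, Complex.ofReal_re]
  rw [← hu, E.scalar_proj measurableSet_Iic] at hi ⊢
  refine (setIntegral_mono_on hi (integrable_const a) measurableSet_Iic fun t ht => ht).trans ?_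
  rw [setIntegral_const, smul_eq_mul, mul_comm, measureReal_def,
    E.scalar_apply _ measurableSet_Iic, ENNReal.toReal_ofReal (by positivity)]

theorem le_re_inner (hT : E.IsIntegral (fun t => t) T) {b : ℝ} (u : T.domain)
    (hu : E.proj (Ici b) (u : X) = u) : b * ‖(u : X)‖ ^ 2 ≤ (⟪(u : X), T u⟫_ℂ).re := by
  have hi := hT.integrable measurable_id u.2
  rw [hT.inner_apply, Complex.ofReal_re]
  rw [← hu, E.scalar_proj measurableSet_Ici] at hi ⊢
  refine le_trans ?_
    (setIntegral_mono_on (integrable_const b) hi measurableSet_Ici fun t ht => ht)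
  rw [setIntegral_const, smul_eq_mul, mul_comm, measureReal_def,
    E.scalar_apply _ measurableSet_Ici, ENNReal.toReal_ofReal (by positivity)]

end IsIntegral

end SpectralMeasure

/-! ### Uniqueness of the spectral resolution of a positive operator -/

namespace SpectralMeasure.IsIntegral

variable {X : Type*} [NormedAddCommGroup X] [InnerProductSpace ℂ X] [CompleteSpace X]
variable {E F : SpectralMeasure X} {J : X →ₗ.[ℂ] X}

/-- A nonzero vector in the range of `E[-n,0]` would lie in the domain and have a nonpositive form
value, against positivity. -/
theorem proj_nonpos_eq_zero (hE : E.IsIntegral (fun t => t) J)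
    (hpos : ∀ u : J.domain, (u : X) ≠ 0 → 0 < (⟪(u : X), J u⟫_ℂ).re) (u : X) :
    E.proj (Iic 0) u = 0 := by
  have key : ∀ n : ℕ, E.proj (Icc (-n : ℝ) 0) u = 0 := by
    intro n
    have hmem := hE.mem_of_bounded (B := Icc (-n : ℝ) 0) measurableSet_Icc (C := n)
      (fun t ht => abs_le.2 ⟨ht.1, ht.2.trans n.cast_nonneg⟩) u
    by_contra hne
    have h1 := hpos ⟨_, hmem⟩ hne
    have h2 := hE.re_inner_le (a := 0) ⟨_, hmem⟩ (E.proj_eq_self_of_subset measurableSet_Icc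
      measurableSet_Iic (fun t ht => ht.2) (E.proj_idem measurableSet_Icc u))
    linarith
  simp only [E.proj_eq_zero_iff measurableSet_Icc] at key
  rw [E.proj_eq_zero_iff measurableSet_Iic]
  have e : Iic (0 : ℝ) ⊆ ⋃ n : ℕ, Icc (-n : ℝ) 0 := by
    intro t ht
    obtain ⟨n, hn⟩ := exists_nat_ge (-t)
    exact mem_iUnion.2 ⟨n, by linarith, ht⟩
  exact measure_mono_null e (measure_iUnion_null key)

theorem mem_domain_of_proj_Iic (hE : E.IsIntegral (fun t => t) J)
    (hpos : ∀ u : J.domain, (u : X) ≠ 0 → 0 < (⟪(u : X), J u⟫_ℂ).re) {a : ℝ} {u : X}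
    (hu : E.proj (Iic a) u = u) : u ∈ J.domain := by
  have h1 : E.proj (Icc 0 a) u = u := by
    have h2 : E.proj (Ioi 0) u = u := by
      rw [← compl_Iic, E.proj_compl measurableSet_Iic, hE.proj_nonpos_eq_zero hpos, sub_zero]
    have h3 : E.proj (Ioi 0 ∩ Iic a) u = u := by
      rw [← E.proj_proj measurableSet_Ioi measurableSet_Iic, hu, h2]
    exact E.proj_eq_self_of_subset (measurableSet_Ioi.inter measurableSet_Iic) measurableSet_Icc
      (fun t ht => ⟨le_of_lt ht.1, ht.2⟩) h3
  rw [← h1]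
  exact hE.mem_of_bounded measurableSet_Icc (C := a)
    (fun t ht => by rw [abs_of_nonneg ht.1]; exact ht.2) u

/-- Since only the quadratic form is tied to `E`, the norm bound is extracted from `0 ≤ ((J-a)u,
J(J-a)u) = (Ju, J(Ju)) - 2a‖Ju‖² + a²(u, Ju)`. The vectors `u` and `Ju` both lie in the range of
`E(-∞,a]`, so the outer terms are at most `a‖Ju‖²` and `a³‖u‖²`. For `a = 0`, where one cannot
divide by `a`, positivity forces `u = 0`. -/
theorem norm_apply_le (hE : E.IsIntegral (fun t => t) J)
    (hsymm : ∀ u v : J.domain, ⟪(u : X), J v⟫_ℂ = ⟪J u, (v : X)⟫_ℂ)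
    (hpos : ∀ u : J.domain, (u : X) ≠ 0 → 0 < (⟪(u : X), J u⟫_ℂ).re) {a : ℝ} (ha : 0 ≤ a)
    (u : J.domain) (hu : E.proj (Iic a) (u : X) = u) : ‖J u‖ ≤ a * ‖(u : X)‖ := by
  have hJu : E.proj (Iic a) (J u) = J u := by
    rw [hE.proj_apply measurable_id measurableSet_Iic]
    congr 1
    exact Subtype.ext hu
  set w : J.domain := ⟨J u, hE.mem_domain_of_proj_Iic hpos hJu⟩ with hw
  have h1 : (⟪(w : X), J w⟫_ℂ).re ≤ a * ‖J u‖ ^ 2 := hE.re_inner_le w hJu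
  have h2 : (⟪(u : X), J u⟫_ℂ).re ≤ a * ‖(u : X)‖ ^ 2 := hE.re_inner_le u hu
  have h3 : 0 ≤ (⟪((w - (a : ℂ) • u : J.domain) : X), J (w - (a : ℂ) • u)⟫_ℂ).re := by
    by_cases h : ((w - (a : ℂ) • u : J.domain) : X) = 0
    · rw [h]; simp
    · exact (hpos _ h).le
  have e : ((w - (a : ℂ) • u : J.domain) : X) = J u - (a : ℂ) • (u : X) := rfl
  have h4 : ⟪(u : X), J w⟫_ℂ = ((‖J u‖ ^ 2 : ℝ) : ℂ) := by
    rw [hsymm u w, inner_self_eq_norm_sq_to_K]; norm_cast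
  have h5 : ⟪J u, J u⟫_ℂ = ((‖J u‖ ^ 2 : ℝ) : ℂ) := by
    rw [inner_self_eq_norm_sq_to_K]; norm_cast
  rw [e, J.map_sub, J.map_smul, inner_sub_left, inner_sub_right, inner_sub_right,
    inner_smul_left, inner_smul_right, inner_smul_left, inner_smul_right, h4, h5,
    Complex.conj_ofReal] at h3
  have e' : (w : X) = J u := rfl
  rw [e'] at h1
  simp only [Complex.sub_re, Complex.mul_re, Complex.ofReal_re, Complex.ofReal_im, zero_mul,
    sub_zero] at h3
  have h6 : a * (a * (⟪(u : X), J u⟫_ℂ).re) ≤ a * (a * (a * ‖(u : X)‖ ^ 2)) := by gcongr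
  rcases ha.eq_or_lt with rfl | ha'
  · have : ‖J u‖ ^ 2 ≤ 0 := by
      have h7 : (u : X) = 0 := by
        by_contra h
        have := hpos u h
        linarith
      have h8 : u = 0 := Subtype.ext h7
      rw [h8, J.map_zero]; simp
    nlinarith [norm_nonneg (J u)]
  · have h7 : a * ‖J u‖ ^ 2 ≤ a * (a * ‖(u : X)‖) ^ 2 := by nlinarith
    exact le_of_sq_le_sq (le_of_mul_le_mul_left h7 ha') (by positivity)

theorem le_norm_apply (hF : F.IsIntegral (fun t => t) J) {b : ℝ} (u : J.domain)
    (hu : F.proj (Ici b) (u : X) = u) : b * ‖(u : X)‖ ≤ ‖J u‖ := by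
  have h1 := hF.le_re_inner u hu
  have h2 : (⟪(u : X), J u⟫_ℂ).re ≤ ‖(u : X)‖ * ‖J u‖ := re_inner_le_norm (𝕜 := ℂ) _ _
  rcases (norm_nonneg (u : X)).eq_or_lt with h | h
  · rw [← h]; simp
  · refine le_of_mul_le_mul_left ?_ h
    nlinarith

/-- Spectral subspaces of two resolutions of the same positive operator that belong to separated
sets are orthogonal. -/
theorem inner_eq_zero_of_lt (hE : E.IsIntegral (fun t => t) J)
    (hF : F.IsIntegral (fun t => t) J)
    (hsymm : ∀ u v : J.domain, ⟪(u : X), J v⟫_ℂ = ⟪J u, (v : X)⟫_ℂ)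
    (hpos : ∀ u : J.domain, (u : X) ≠ 0 → 0 < (⟪(u : X), J u⟫_ℂ).re)
    (hsurj : ∀ x : X, ∃ u : J.domain, J u = x) {a b : ℝ} (ha : 0 ≤ a) (hab : a < b) {u v : X}
    (hu : E.proj (Iic a) u = u) (hv : F.proj (Ici b) v = v) : ⟪u, v⟫_ℂ = 0 := by
  have hb : 0 < b := ha.trans_lt hab
  -- Write `v = J w'` with `w'` in the range of `F[b,∞)`; then `⟪u, v⟫ = ⟪J u, w'⟫` with `‖J u‖ ≤
  -- a‖u‖` and `‖w'‖ ≤ ‖v‖ / b`. Both new vectors stay in their spectral subspaces, so the step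
  -- iterates.
  have key : ∀ n : ℕ, ∀ u v : X, E.proj (Iic a) u = u → F.proj (Ici b) v = v →
      ‖⟪u, v⟫_ℂ‖ ≤ (a / b) ^ n * (‖u‖ * ‖v‖) := by
    intro n
    induction n with
    | zero => intro u v _ _; simpa using norm_inner_le_norm u v
    | succ n ih =>
      intro u v hu hv
      obtain ⟨w, hw⟩ := hsurj v
      set w' : J.domain := ⟨F.proj (Ici b) w, hF.proj_mem measurableSet_Ici w.2⟩ with hw'
      have hJw : J w' = v := by
        rw [hw', ← hF.proj_apply measurable_id measurableSet_Ici, hw, hv]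
      have hFw : F.proj (Ici b) (w' : X) = w' := F.proj_idem measurableSet_Ici _
      set u' : J.domain := ⟨u, hE.mem_domain_of_proj_Iic hpos hu⟩ with hu'
      have hJu : E.proj (Iic a) (J u') = J u' := by
        rw [hE.proj_apply measurable_id measurableSet_Iic]
        congr 1
        exact Subtype.ext hu
      have h1 : ⟪u, v⟫_ℂ = ⟪J u', (w' : X)⟫_ℂ := by rw [← hsymm, hJw]
      have h2 := hE.norm_apply_le hsymm hpos ha u' hu
      have h3 := hF.le_norm_apply w' hFw
      rw [hJw] at h3
      have h4 : ‖(w' : X)‖ ≤ ‖v‖ / b := by rwa [le_div_iff₀' hb]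
      have h2' : ‖J u'‖ ≤ a * ‖u‖ := h2
      have h5 : 0 ≤ a / b := by positivity
      calc ‖⟪u, v⟫_ℂ‖ ≤ (a / b) ^ n * (‖J u'‖ * ‖(w' : X)‖) := by rw [h1]; exact ih _ _ hJu hFw
        _ ≤ (a / b) ^ n * ((a * ‖u‖) * (‖v‖ / b)) := by gcongr
        _ = _ := by rw [pow_succ]; ring
  have hlim : Tendsto (fun n : ℕ => (a / b) ^ n * (‖u‖ * ‖v‖)) atTop (𝓝 (0 * (‖u‖ * ‖v‖))) :=
    (tendsto_pow_atTop_nhds_zero_of_lt_one (by positivity) ((div_lt_one hb).2 hab)).mul_const _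
  rw [zero_mul] at hlim
  have := ge_of_tendsto' hlim fun n => key n u v hu hv
  exact norm_le_zero_iff.1 this

/-- For `b > a`, the vector `u = E(-∞,a]x` is orthogonal to `F[b,∞)u`, so the latter vanishes.
Letting `b` decrease to `a` gives `F(a,∞)u = 0`. -/
theorem proj_Iic_proj_Iic (hE : E.IsIntegral (fun t => t) J)
    (hF : F.IsIntegral (fun t => t) J)
    (hsymm : ∀ u v : J.domain, ⟪(u : X), J v⟫_ℂ = ⟪J u, (v : X)⟫_ℂ)
    (hpos : ∀ u : J.domain, (u : X) ≠ 0 → 0 < (⟪(u : X), J u⟫_ℂ).re)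
    (hsurj : ∀ x : X, ∃ u : J.domain, J u = x) (a : ℝ) (x : X) :
    F.proj (Iic a) (E.proj (Iic a) x) = E.proj (Iic a) x := by
  set u := E.proj (Iic a) x with hu_def
  have hu : E.proj (Iic a) u = u := E.proj_idem measurableSet_Iic x
  rcases lt_or_ge a 0 with ha | ha
  · have h0 : u = 0 := by
      rw [← E.proj_eq_self_of_subset measurableSet_Iic measurableSet_Iic
        (Iic_subset_Iic.2 ha.le) hu]
      exact hE.proj_nonpos_eq_zero hpos u
    rw [h0, map_zero]
  · have h1 : ∀ b, a < b → F.proj (Ici b) u = 0 := by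
      intro b hb
      have h := hE.inner_eq_zero_of_lt hF hsymm hpos hsurj ha hb hu
        (F.proj_idem measurableSet_Ici u)
      rw [F.inner_proj measurableSet_Ici] at h
      have h' : ‖F.proj (Ici b) u‖ ^ 2 = 0 := by exact_mod_cast h
      simpa using h'
    have h2 : F.proj (Ioi a) u = 0 := by
      rw [F.proj_eq_zero_iff measurableSet_Ioi]
      have e : Ioi a ⊆ ⋃ n : ℕ, Ici (a + 1 / (n + 1)) := by
        intro t (ht : a < t)
        obtain ⟨n, hn⟩ := exists_nat_one_div_lt (sub_pos.2 ht)
        exact mem_iUnion.2 ⟨n, by rw [mem_Ici]; linarith⟩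
      refine measure_mono_null e (measure_iUnion_null fun n => ?_)
      rw [← F.proj_eq_zero_iff measurableSet_Ici]
      exact h1 _ (by linarith [Nat.one_div_pos_of_nat (α := ℝ) (n := n)])
    rw [← compl_Ioi, F.proj_compl measurableSet_Ioi, h2, sub_zero]

/-- The scalar measures of a spectral resolution of a positive surjective symmetric operator are
determined by the operator. -/
theorem scalar_eq (hE : E.IsIntegral (fun t => t) J) (hF : F.IsIntegral (fun t => t) J)
    (hsymm : ∀ u v : J.domain, ⟪(u : X), J v⟫_ℂ = ⟪J u, (v : X)⟫_ℂ)
    (hpos : ∀ u : J.domain, (u : X) ≠ 0 → 0 < (⟪(u : X), J u⟫_ℂ).re)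
    (hsurj : ∀ x : X, ∃ u : J.domain, J u = x) (u : X) : E.scalar u = F.scalar u := by
  refine SpectralMeasure.scalar_ext_of_proj (fun a => ?_) u
  ext x
  refine ext_inner_left ℂ fun y => ?_
  -- With `E`, `F` denoting the projections of `(-∞,a]`, `F E = E` and by symmetry `E F = F`;
  -- self-adjointness then gives `E = F`.
  rw [← hE.proj_Iic_proj_Iic hF hsymm hpos hsurj a x, ← F.inner_proj_left measurableSet_Iic,
    ← E.inner_proj_left measurableSet_Iic, hF.proj_Iic_proj_Iic hE hsymm hpos hsurj a y,
    F.inner_proj_left measurableSet_Iic]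

end SpectralMeasure.IsIntegral

/-! ### Uniqueness of the generating operator -/

namespace IsGeneratingOperator

variable {X₀ X₁ : Type*} [NormedAddCommGroup X₀] [InnerProductSpace ℂ X₀] [CompleteSpace X₀]
  [NormedAddCommGroup X₁] [InnerProductSpace ℂ X₁] {ι : X₁ →ₗ[ℂ] X₀} {J J' : X₀ →ₗ.[ℂ] X₀}

theorem dense_domain (h : IsGeneratingOperator ι J) (hd : DenseRange ι) :
    Dense (J.domain : Set X₀) := by
  rw [h.domain_eq]
  exact hd

theorem inner_apply_right (h : IsGeneratingOperator ι J) (hd : DenseRange ι) (u v : J.domain) :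
    ⟪(u : X₀), J v⟫_ℂ = ⟪J u, (v : X₀)⟫_ℂ := by
  have hf := LinearPMap.adjoint_isFormalAdjoint (h.dense_domain hd)
  rw [(LinearPMap.isSelfAdjoint_def (A := J)).1 h.selfAdjoint] at hf
  exact (hf u v).symm

theorem exists_apply_eq (h : IsGeneratingOperator ι J) (x : X₀) : ∃ u : J.domain, J u = x := by
  obtain ⟨V, hV⟩ := h.isometricIso
  refine ⟨⟨ι (V.symm x), by rw [h.domain_eq]; exact ⟨_, rfl⟩⟩, ?_⟩
  rw [hV (V.symm x) _ rfl, V.apply_symm_apply]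

/-- The inverse of the generating operator is the positive square root of `ι ι*`. -/
theorem exists_inverse [CompleteSpace X₁] (h : IsGeneratingOperator ι J) (hc : Continuous ι)
    (hd : DenseRange ι) :
    ∃ A : X₀ →L[ℂ] X₀, 0 ≤ A ∧ (∀ u : J.domain, A (J u) = u) ∧
      A * A = (⟨ι, hc⟩ : X₁ →L[ℂ] X₀) ∘L ContinuousLinearMap.adjoint ⟨ι, hc⟩ := by
  obtain ⟨V, hV⟩ := h.isometricIso
  set i : X₁ →L[ℂ] X₀ := ⟨ι, hc⟩ with hi
  -- `A = ι V⁻¹` inverts `J`. Being self-adjoint, it also equals `V ι*`, whence `A A = ι V⁻¹ V ι* =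
  -- ι ι*`.
  let A : X₀ →L[ℂ] X₀ := i ∘L (V.symm.toContinuousLinearEquiv : X₀ →L[ℂ] X₁)
  have hA : ∀ x, A x = ι (V.symm x) := fun x => rfl
  have hAJ : ∀ u : J.domain, A (J u) = u := by
    intro u
    obtain ⟨v, hv⟩ : (u : X₀) ∈ LinearMap.range ι := h.domain_eq ▸ u.2
    rw [hA, hV v u hv.symm, V.symm_apply_apply, hv]
  have hsymm : ∀ x y, ⟪A x, y⟫_ℂ = ⟪x, A y⟫_ℂ := by
    intro x y
    obtain ⟨u, rfl⟩ := h.exists_apply_eq x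
    obtain ⟨v, rfl⟩ := h.exists_apply_eq y
    rw [hAJ, hAJ, h.inner_apply_right hd]
  refine ⟨A, ?_, hAJ, ?_⟩
  · rw [ContinuousLinearMap.nonneg_iff_isPositive, ContinuousLinearMap.isPositive_iff]
    refine ⟨fun x y => hsymm x y, fun x => ?_⟩
    obtain ⟨u, rfl⟩ := h.exists_apply_eq x
    have him : (⟪A (J u), J u⟫_ℂ).im = 0 := by
      have := inner_conj_symm (𝕜 := ℂ) (A (J u)) (J u)
      rw [← hsymm] at this
      exact Complex.conj_eq_iff_im.1 this
    rw [Complex.le_def]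
    refine ⟨?_, by rw [him]; rfl⟩
    rw [hAJ, Complex.zero_re]
    by_cases h0 : (u : X₀) = 0
    · rw [h0]; simp
    · exact (h.positive u h0).le
  · ext y
    have h1 : A y = V (ContinuousLinearMap.adjoint i y) := by
      refine ext_inner_right ℂ fun x => ?_
      rw [hsymm, hA, ← V.apply_symm_apply x, V.inner_map_map, V.symm_apply_apply,
        ContinuousLinearMap.adjoint_inner_left]
      rfl
    change A (A y) = ι (ContinuousLinearMap.adjoint i y)
    rw [h1, hA, V.symm_apply_apply]

/-- The generating operator of an admissible couple is unique. -/
theorem unique (hι : IsAdmissibleCouple ι) (h : IsGeneratingOperator ι J)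
    (h' : IsGeneratingOperator ι J') : J = J' := by
  have := hι.complete₁
  obtain ⟨A, hA, hAJ, hAA⟩ := h.exists_inverse hι.continuous hι.dense
  obtain ⟨A', hA', hAJ', hAA'⟩ := h'.exists_inverse hι.continuous hι.dense
  have hE : A = A' := (CFC.mul_self_eq_mul_self_iff A A' hA hA').1 (hAA.trans hAA'.symm)
  have hdom : J.domain = J'.domain := h.domain_eq.trans h'.domain_eq.symm
  refine LinearPMap.ext hdom fun u hu hu' => ?_
  -- If `J v = J' u`, applying the common inverse gives `v = u`.
  obtain ⟨v, hv⟩ := h.exists_apply_eq (J' ⟨u, hu'⟩)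
  have h1 := hAJ v
  rw [hv, hE, hAJ'] at h1
  have h2 : (⟨u, hu⟩ : J.domain) = v := Subtype.ext h1
  rw [h2, hv]

end IsGeneratingOperator

noncomputable section

/-! ### Multiplication operators -/

section Multiplication

variable {α : Type*} [MeasurableSpace α] {ν : Measure α}

/-- Multiplication by the indicator function of `S` on `L₂`. -/
def indicatorLp {S : Set α} (hS : MeasurableSet S) : Lp ℂ 2 ν →L[ℂ] Lp ℂ 2 ν :=
  LinearMap.mkContinuous
    { toFun := fun h => ((Lp.memLp h).indicator hS).toLp _
      map_add' := fun g h => by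
        rw [← MemLp.toLp_add]
        refine MemLp.toLp_congr _ _ ?_
        filter_upwards [Lp.coeFn_add g h] with x hx
        rw [← Set.indicator_add']
        by_cases hxS : x ∈ S
        · rw [indicator_of_mem hxS, indicator_of_mem hxS, hx]
        · rw [indicator_of_notMem hxS, indicator_of_notMem hxS]
      map_smul' := fun c h => by
        rw [RingHom.id_apply, ← MemLp.toLp_const_smul]
        refine MemLp.toLp_congr _ _ ?_
        filter_upwards [Lp.coeFn_smul c h] with x hx
        by_cases hxS : x ∈ S
        · rw [Pi.smul_apply, indicator_of_mem hxS, indicator_of_mem hxS, hx, Pi.smul_apply]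
        · rw [Pi.smul_apply, indicator_of_notMem hxS, indicator_of_notMem hxS, smul_zero] }
    1 fun h => by
      rw [one_mul]
      refine Lp.norm_le_norm_of_ae_le ?_
      filter_upwards [((Lp.memLp h).indicator hS).coeFn_toLp] with x hx
      simp only [LinearMap.coe_mk, AddHom.coe_mk]
      rw [hx]
      exact norm_indicator_le_norm_self _ _

theorem coeFn_indicatorLp {S : Set α} (hS : MeasurableSet S) (h : Lp ℂ 2 ν) :
    indicatorLp hS h =ᵐ[ν] S.indicator h :=
  ((Lp.memLp h).indicator hS).coeFn_toLp

theorem indicatorLp_congr {S T : Set α} (hS : MeasurableSet S) (hT : MeasurableSet T) (h : S = T) :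
    (indicatorLp hS : Lp ℂ 2 ν →L[ℂ] Lp ℂ 2 ν) = indicatorLp hT := by
  subst h; rfl

theorem indicatorLp_indicatorLp {S T : Set α} (hS : MeasurableSet S) (hT : MeasurableSet T)
    (h : Lp ℂ 2 ν) : indicatorLp hS (indicatorLp hT h) = indicatorLp (hS.inter hT) h := by
  refine Lp.ext ?_
  filter_upwards [coeFn_indicatorLp hS (indicatorLp hT h), coeFn_indicatorLp hT h,
    coeFn_indicatorLp (hS.inter hT) h] with x h1 h2 h3
  rw [h1, h3, ← indicator_indicator]
  by_cases hxS : x ∈ S <;> simp [hxS, h2]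

theorem inner_indicatorLp {S : Set α} (hS : MeasurableSet S) (g h : Lp ℂ 2 ν) :
    ⟪indicatorLp hS g, h⟫_ℂ = ⟪g, indicatorLp hS h⟫_ℂ := by
  rw [L2.inner_def, L2.inner_def]
  refine integral_congr_ae ?_
  filter_upwards [coeFn_indicatorLp hS g, coeFn_indicatorLp hS h] with x h1 h2
  rw [h1, h2]
  by_cases hxS : x ∈ S <;> simp [hxS]

theorem enorm_sq_eq_lintegral (h : Lp ℂ 2 ν) : ‖h‖ₑ ^ 2 = ∫⁻ x, ‖h x‖ₑ ^ 2 ∂ν := by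
  have := eLpNorm_nnreal_pow_eq_lintegral (f := (h : α → ℂ)) (μ := ν) (p := 2) (by norm_num)
  rw [Lp.enorm_def]
  simpa using this

/-- The measure with density `|h|²`. -/
def sqDensity (h : Lp ℂ 2 ν) : Measure α := ν.withDensity fun x => ‖h x‖ₑ ^ 2

instance (h : Lp ℂ 2 ν) : IsFiniteMeasure (sqDensity h) := by
  refine isFiniteMeasure_withDensity ?_
  rw [← enorm_sq_eq_lintegral]
  finiteness

theorem sqDensity_apply (h : Lp ℂ 2 ν) {S : Set α} (hS : MeasurableSet S) :
    sqDensity h S = ‖indicatorLp hS h‖ₑ ^ 2 := by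
  rw [sqDensity, withDensity_apply _ hS, enorm_sq_eq_lintegral, ← lintegral_indicator hS]
  refine lintegral_congr_ae ?_
  filter_upwards [coeFn_indicatorLp hS h] with x hx
  rw [hx]
  by_cases hxS : x ∈ S <;> simp [hxS]

theorem sqDensity_real_apply (h : Lp ℂ 2 ν) {S : Set α} (hS : MeasurableSet S) :
    (sqDensity h).real S = ‖indicatorLp hS h‖ ^ 2 := by
  rw [measureReal_def, sqDensity_apply h hS, ENNReal.toReal_pow, toReal_enorm]

/-- The squared norm of a remainder is the mass that the finite measure `|h|² dν` gives to the sets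
not yet summed, and this tends to zero. -/
theorem hasSum_indicatorLp {S : ℕ → Set α} (hS : ∀ i, MeasurableSet (S i))
    (hd : Pairwise (Function.onFun Disjoint S)) (h : Lp ℂ 2 ν) :
    HasSum (fun i => indicatorLp (hS i) h) (indicatorLp (.iUnion hS) h) := by
  have hfin : ∀ s : Finset ℕ, ∑ i ∈ s, indicatorLp (hS i) h =
      indicatorLp (s.measurableSet_biUnion fun i _ => hS i) h := by
    intro s
    refine Lp.ext ?_
    have h1 : ∀ᵐ x ∂ν, ∀ i, indicatorLp (hS i) h x = (S i).indicator h x :=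
      ae_all_iff.2 fun i => coeFn_indicatorLp (hS i) h
    filter_upwards [Lp.coeFn_finsetSum s (fun i => indicatorLp (hS i) h), h1,
      coeFn_indicatorLp (s.measurableSet_biUnion fun i _ => hS i) h] with x h1 h2 h3
    rw [h1, h3, Finset.sum_apply, Finset.indicator_biUnion_apply]
    · exact Finset.sum_congr rfl fun i _ => h2 i
    · exact fun i _ j _ hij => hd hij
  have hsub : ∀ s : Finset ℕ, indicatorLp (.iUnion hS) h - ∑ i ∈ s, indicatorLp (hS i) h =
      indicatorLp ((MeasurableSet.iUnion hS).diff (s.measurableSet_biUnion fun i _ => hS i)) h := by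
    intro s
    rw [hfin]
    refine Lp.ext ?_
    filter_upwards [Lp.coeFn_sub (indicatorLp (.iUnion hS) h)
      (indicatorLp (s.measurableSet_biUnion fun i _ => hS i) h),
      coeFn_indicatorLp (.iUnion hS) h,
      coeFn_indicatorLp (s.measurableSet_biUnion fun i _ => hS i) h, coeFn_indicatorLp
        ((MeasurableSet.iUnion hS).diff (s.measurableSet_biUnion fun i _ => hS i)) h]
      with x h1 h2 h3 h4
    rw [h1, h4, Pi.sub_apply, h2, h3, indicator_sdiff (iUnion₂_subset fun i _ => subset_iUnion S i)]
    rfl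
  have hreal : HasSum (fun i => (sqDensity h).real (S i)) ((sqDensity h).real (⋃ i, S i)) := by
    have hm := measure_iUnion (μ := sqDensity h) hd hS
    rw [measureReal_def, hm, ENNReal.tsum_toReal_eq (fun i => measure_ne_top _ _)]
    refine (ENNReal.summable_toReal ?_).hasSum
    rw [← hm]
    exact measure_ne_top _ _
  have hnorm : Tendsto (fun s : Finset ℕ =>
      ‖indicatorLp (.iUnion hS) h - ∑ i ∈ s, indicatorLp (hS i) h‖ ^ 2) atTop (𝓝 0) := by
    have h1 := hreal.const_sub ((sqDensity h).real (⋃ i, S i))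
    rw [sub_self] at h1
    refine h1.congr fun s => ?_
    rw [hsub, ← sqDensity_real_apply,
      measureReal_sdiff (iUnion₂_subset fun i _ => subset_iUnion S i)
      (s.measurableSet_biUnion fun i _ => hS i), measureReal_biUnion_finset
      (fun i _ j _ hij => hd hij) (fun i _ => hS i)]
  rw [HasSum, tendsto_iff_norm_sub_tendsto_zero]
  have h2 := hnorm.sqrt
  rw [Real.sqrt_zero] at h2
  refine h2.congr fun s => ?_
  rw [Real.sqrt_sq (norm_nonneg _), norm_sub_rev]

variable {X : Type*} [NormedAddCommGroup X] [InnerProductSpace ℂ X]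

/-- The spectral measure of the operator of multiplication by a measurable real function `m`, on a
Hilbert space that is identified with `L₂`. -/
def mulSpectralMeasure [CompleteSpace X] (U : X ≃ₗᵢ[ℂ] Lp ℂ 2 ν) {m : α → ℝ} (hm : Measurable m) :
    SpectralMeasure X where
  proj B := open Classical in if hB : MeasurableSet B then
    (U.symm.toContinuousLinearEquiv : Lp ℂ 2 ν →L[ℂ] X) ∘L indicatorLp (hm hB) ∘L
      (U.toContinuousLinearEquiv : X →L[ℂ] Lp ℂ 2 ν) else 0
  isStarProjection' B hB := by
    rw [dif_pos hB]
    constructor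
    · ext u
      change U.symm (indicatorLp (hm hB) (U (U.symm (indicatorLp (hm hB) (U u))))) =
        U.symm (indicatorLp (hm hB) (U u))
      rw [U.apply_symm_apply, indicatorLp_indicatorLp]
      rw [indicatorLp_congr _ (hm hB) (inter_self _)]
    · rw [ContinuousLinearMap.isSelfAdjoint_iff_isSymmetric]
      intro u v
      change ⟪U.symm (indicatorLp (hm hB) (U u)), v⟫_ℂ = ⟪u, U.symm (indicatorLp (hm hB) (U v))⟫_ℂ
      rw [← U.inner_map_map, ← U.inner_map_map u, U.apply_symm_apply, U.apply_symm_apply,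
        inner_indicatorLp]
  proj_univ' := by
    rw [dif_pos .univ]
    ext u
    change U.symm (indicatorLp (hm .univ) (U u)) = u
    rw [U.symm_apply_eq]
    refine Lp.ext ?_
    filter_upwards [coeFn_indicatorLp (hm .univ) (U u)] with x hx
    simpa using hx
  proj_inter' A B hA hB := by
    rw [dif_pos hA, dif_pos hB, dif_pos (hA.inter hB)]
    ext u
    change U.symm (indicatorLp (hm (hA.inter hB)) (U u)) =
      U.symm (indicatorLp (hm hA) (U (U.symm (indicatorLp (hm hB) (U u)))))
    rw [U.apply_symm_apply, indicatorLp_indicatorLp]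
    rfl
  hasSum_iUnion' B hB hd u := by
    rw [dif_pos (.iUnion hB)]
    have h := (hasSum_indicatorLp (fun i => hm (hB i))
      (fun i j hij => (hd hij).preimage m) (U u)).mapL
        (U.symm.toContinuousLinearEquiv : Lp ℂ 2 ν →L[ℂ] X)
    convert h using 1
    · ext i
      rw [dif_pos (hB i)]
      rfl
    · change U.symm (indicatorLp (hm (.iUnion hB)) (U u)) = U.symm (indicatorLp _ (U u))
      rw [indicatorLp_congr _ _ preimage_iUnion]

theorem mulSpectralMeasure_proj [CompleteSpace X] (U : X ≃ₗᵢ[ℂ] Lp ℂ 2 ν)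
    {m : α → ℝ} (hm : Measurable m)
    {B : Set ℝ} (hB : MeasurableSet B) (u : X) :
    (mulSpectralMeasure U hm).proj B u = U.symm (indicatorLp (hm hB) (U u)) := by
  simp only [mulSpectralMeasure, dif_pos hB]
  rfl

/-- Reduces spectral integrals to integrals of `f(m) |U u|²` by change of variables. -/
theorem mulSpectralMeasure_scalar [CompleteSpace X] (U : X ≃ₗᵢ[ℂ] Lp ℂ 2 ν)
    {m : α → ℝ} (hm : Measurable m)
    (u : X) : (mulSpectralMeasure U hm).scalar u = (sqDensity (U u)).map m := by
  ext B hB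
  rw [SpectralMeasure.scalar_apply _ _ hB, Measure.map_apply hm hB, sqDensity_apply _ (hm hB),
    mulSpectralMeasure_proj U hm hB, U.symm.norm_map, ENNReal.ofReal_pow (norm_nonneg _),
    ofReal_norm]

/-- The vectors `u` for which the product of `g` and the function `U u` is in `L₂`. -/
def mulDomain (U : X ≃ₗᵢ[ℂ] Lp ℂ 2 ν) (g : α → ℝ) : Submodule ℂ X where
  carrier := {u | MemLp (fun x => (g x : ℂ) * U u x) 2 ν}
  zero_mem' := by
    refine (MemLp.zero (ε := ℂ)).ae_eq ?_
    rw [map_zero]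
    filter_upwards [Lp.coeFn_zero ℂ 2 ν] with x hx
    rw [hx]
    simp
  add_mem' := by
    intro u v hu hv
    refine (MemLp.add hu hv).ae_eq ?_
    rw [map_add]
    filter_upwards [Lp.coeFn_add (U u) (U v)] with x hx
    rw [hx, Pi.add_apply, Pi.add_apply, mul_add]
  smul_mem' := by
    intro c u hu
    refine (MemLp.const_smul hu c).ae_eq ?_
    rw [map_smul]
    filter_upwards [Lp.coeFn_smul c (U u)] with x hx
    rw [hx, Pi.smul_apply, Pi.smul_apply, smul_eq_mul, smul_eq_mul, mul_left_comm]

theorem mem_mulDomain {U : X ≃ₗᵢ[ℂ] Lp ℂ 2 ν} {g : α → ℝ} {u : X} :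
    u ∈ mulDomain U g ↔ MemLp (fun x => (g x : ℂ) * U u x) 2 ν := Iff.rfl

/-- The product of `g` and `U u` as an element of `L₂`. -/
def mulLp (U : X ≃ₗᵢ[ℂ] Lp ℂ 2 ν) (g : α → ℝ) : mulDomain U g →ₗ[ℂ] Lp ℂ 2 ν where
  toFun u := MemLp.toLp _ (mem_mulDomain.1 u.2)
  map_add' u v := by
    rw [← MemLp.toLp_add]
    refine MemLp.toLp_congr _ _ ?_
    rw [Submodule.coe_add, map_add]
    filter_upwards [Lp.coeFn_add (U u) (U v)] with x hx
    rw [hx, Pi.add_apply, Pi.add_apply, mul_add]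
  map_smul' c u := by
    rw [RingHom.id_apply, ← MemLp.toLp_const_smul]
    refine MemLp.toLp_congr _ _ ?_
    rw [Submodule.coe_smul, map_smul]
    filter_upwards [Lp.coeFn_smul c (U u)] with x hx
    rw [hx, Pi.smul_apply, Pi.smul_apply, smul_eq_mul, smul_eq_mul, mul_left_comm]

/-- The operator of multiplication by a real function `g` with its maximal domain, on a Hilbert
space that is identified with `L₂`. -/
def mulPMap (U : X ≃ₗᵢ[ℂ] Lp ℂ 2 ν) (g : α → ℝ) : X →ₗ.[ℂ] X where
  domain := mulDomain U g
  toFun := U.symm.toLinearEquiv.toLinearMap ∘ₗ mulLp U g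

theorem mem_mulPMap_domain {U : X ≃ₗᵢ[ℂ] Lp ℂ 2 ν} {g : α → ℝ} {u : X} :
    u ∈ (mulPMap U g).domain ↔ MemLp (fun x => (g x : ℂ) * U u x) 2 ν := Iff.rfl

theorem coeFn_mulPMap (U : X ≃ₗᵢ[ℂ] Lp ℂ 2 ν) (g : α → ℝ) (u : (mulPMap U g).domain) :
    U (mulPMap U g u) =ᵐ[ν] fun x => (g x : ℂ) * U u x := by
  change U (U.symm (mulLp U g u)) =ᵐ[ν] _
  rw [U.apply_symm_apply]
  exact (mem_mulDomain.1 u.2).coeFn_toLp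

theorem inner_mulPMap (U : X ≃ₗᵢ[ℂ] Lp ℂ 2 ν) (g : α → ℝ) (u v : (mulPMap U g).domain) :
    ⟪(u : X), mulPMap U g v⟫_ℂ = ⟪mulPMap U g u, (v : X)⟫_ℂ := by
  rw [← U.inner_map_map, ← U.inner_map_map (mulPMap U g u), L2.inner_def, L2.inner_def]
  refine integral_congr_ae ?_
  filter_upwards [coeFn_mulPMap U g u, coeFn_mulPMap U g v] with x h1 h2
  rw [h1, h2]
  simp only [RCLike.inner_apply, map_mul, Complex.conj_ofReal]
  ring

theorem inner_mulPMap_self (U : X ≃ₗᵢ[ℂ] Lp ℂ 2 ν) (g : α → ℝ) (u : (mulPMap U g).domain) :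
    ⟪(u : X), mulPMap U g u⟫_ℂ = ((∫ x, g x * ‖U u x‖ ^ 2 ∂ν : ℝ) : ℂ) := by
  rw [← U.inner_map_map, L2.inner_def, ← integral_complex_ofReal]
  refine integral_congr_ae ?_
  filter_upwards [coeFn_mulPMap U g u] with x h1
  rw [h1]
  simp only [RCLike.inner_apply, mul_assoc, Complex.mul_conj, Complex.normSq_eq_norm_sq]
  push_cast
  ring

/-- Borel functions of a multiplication operator are multiplication operators. -/
theorem isIntegral_mulPMap [CompleteSpace X] (U : X ≃ₗᵢ[ℂ] Lp ℂ 2 ν) {m : α → ℝ}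
    (hm : Measurable m) {f : ℝ → ℝ} (hf : Measurable f) :
    (mulSpectralMeasure U hm).IsIntegral f (mulPMap U fun x => f (m x)) where
  mem_domain_iff u := by
    have hUm : AEStronglyMeasurable (U u) ν := Lp.aestronglyMeasurable _
    have hgm : AEStronglyMeasurable (fun x => ((f (m x) : ℝ) : ℂ) * U u x) ν :=
      (Complex.measurable_ofReal.comp (hf.comp hm)).aestronglyMeasurable.mul hUm
    rw [mulSpectralMeasure_scalar, lintegral_map (by fun_prop) hm, sqDensity,
      lintegral_withDensity_eq_lintegral_mul₀ (hUm.enorm.pow_const 2) (by fun_prop),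
      mem_mulPMap_domain, MemLp, and_iff_right hgm]
    have h1 := eLpNorm_nnreal_pow_eq_lintegral (f := fun x => ((f (m x) : ℝ) : ℂ) * U u x)
      (μ := ν) (p := 2) (by norm_num)
    have h2 : ∀ x, ENNReal.ofReal (f (m x) ^ 2) = ‖((f (m x) : ℝ) : ℂ)‖ₑ ^ 2 := fun x => by
      rw [← ofReal_norm, Complex.norm_real, Real.norm_eq_abs,
        ← ENNReal.ofReal_pow (abs_nonneg _), sq_abs]
    have h3 : ∫⁻ x, ((fun x => ‖U u x‖ₑ ^ 2) * fun x => ENNReal.ofReal (f (m x) ^ 2)) x ∂ν =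
        eLpNorm (fun x => ((f (m x) : ℝ) : ℂ) * U u x) 2 ν ^ 2 := by
      have h4 : eLpNorm (fun x => ((f (m x) : ℝ) : ℂ) * U u x) 2 ν ^ 2 =
          ∫⁻ x, ‖((f (m x) : ℝ) : ℂ) * U u x‖ₑ ^ 2 ∂ν := by simpa using h1
      rw [h4]
      refine lintegral_congr fun x => ?_
      rw [Pi.mul_apply, h2, enorm_mul, mul_pow, mul_comm]
    rw [h3]
    exact (ENNReal.pow_lt_top_iff (n := 2)).trans (by simp) |>.symm
  inner_apply u := by
    have hUm : AEStronglyMeasurable (U u) ν := Lp.aestronglyMeasurable _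
    rw [inner_mulPMap_self, mulSpectralMeasure_scalar,
      integral_map hm.aemeasurable hf.aestronglyMeasurable, sqDensity,
      integral_withDensity_eq_integral_toReal_smul₀ (hUm.enorm.pow_const 2)
        (ae_of_all _ fun x => by finiteness)]
    congr 1
    refine integral_congr_ae (ae_of_all _ fun x => ?_)
    simp [mul_comm]

/-- A densely defined symmetric surjective operator is self-adjoint. -/
theorem LinearPMap.isSelfAdjoint_of_surjective [CompleteSpace X] {T : X →ₗ.[ℂ] X}
    (hd : Dense (T.domain : Set X))
    (hsymm : ∀ u v : T.domain, ⟪(u : X), T v⟫_ℂ = ⟪T u, (v : X)⟫_ℂ)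
    (hsurj : ∀ x : X, ∃ u : T.domain, T u = x) : IsSelfAdjoint T := by
  rw [LinearPMap.isSelfAdjoint_def]
  have hle : T ≤ T.adjoint :=
    LinearPMap.IsFormalAdjoint.le_adjoint hd fun u v => (hsymm u v).symm
  refine (LinearPMap.eq_of_le_of_domain_eq hle (le_antisymm hle.1 fun y hy => ?_)).symm
  -- If `T* y = T z`, then `⟪y, T v⟫ = ⟪T z, v⟫ = ⟪z, T v⟫` for all `v`. As `T` is onto, `y = z`
  -- lies in the domain of `T`.
  obtain ⟨z, hz⟩ := hsurj (T.adjoint ⟨y, hy⟩)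
  have hyz : y = z := by
    refine ext_inner_right ℂ fun x => ?_
    obtain ⟨v, rfl⟩ := hsurj x
    have h := LinearPMap.adjoint_isFormalAdjoint hd ⟨y, hy⟩ v
    rw [← hz] at h
    rw [hsymm, h]
  rw [hyz]
  exact z.2

end Multiplication

end

noncomputable section

/-! ### The couple of anisotropic Sobolev spaces -/

namespace RefinedSobolev

variable {b : ℕ} {s : ℝ} {φ : SlowParam}

theorem coeFn_toL2 (w : RefinedSobolev b s φ) :
    toL2 w =ᵐ[volume] fun ξ => (rWeight b s φ ξ : ℂ) * w.fourier ξ :=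
  w.memLp.coeFn_toLp

end RefinedSobolev

/-- From `φ(r) ≥ c r^{-(s-s₀)}` one gets `r^{s₀} ≤ c⁻¹ r^s φ(r)`. This guarantees that every element
of `H^{s,sγ,φ}` is available in the space where `ψ(J)` acts. -/
theorem refinedSobolev_le_of_lt (b : ℕ) {s₀ s : ℝ} (φ : SlowParam) (h : s₀ < s) :
    refinedSobolev b s φ ≤ refinedSobolev b s₀ 1 := by
  obtain ⟨c, hc, hle⟩ := φ.exists_rpow_neg_le (sub_pos.2 h)
  rintro w ⟨g, hg, i⟩
  have hgm := hg.1.aestronglyMeasurable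
  rw [← memLp_rWeight_iff hgm] at i
  refine ⟨g, hg, (memLp_rWeight_iff hgm).1 ?_⟩
  refine MemLp.of_le_mul (c := c⁻¹) i ((Complex.measurable_ofReal.comp
    (measurable_rWeight b s₀ 1)).aestronglyMeasurable.mul hgm) (ae_of_all _ fun ξ => ?_)
  have hr := rGamma_pos b ξ
  rw [norm_mul, norm_mul, ← mul_assoc, Complex.norm_real, Complex.norm_real, Real.norm_eq_abs,
    Real.norm_eq_abs, abs_of_pos (rWeight_pos b s₀ 1 ξ), abs_of_pos (rWeight_pos b s φ ξ)]
  refine mul_le_mul_of_nonneg_right ?_ (norm_nonneg _)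
  have h1 := hle _ (one_le_rGamma b ξ)
  have h2 : rGamma b ξ ^ s₀ = rGamma b ξ ^ s * rGamma b ξ ^ (-(s - s₀)) := by
    rw [← Real.rpow_add hr]; congr 1; ring
  rw [rWeight, rWeight, SlowParam.one_apply, mul_one, le_inv_mul_iff₀ hc, h2]
  calc c * (rGamma b ξ ^ s * rGamma b ξ ^ (-(s - s₀)))
      = rGamma b ξ ^ s * (c * rGamma b ξ ^ (-(s - s₀))) := by ring
    _ ≤ _ := mul_le_mul_of_nonneg_left h1 (Real.rpow_nonneg hr.le _)

namespace AnisoSobolev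

open RefinedSobolev

/-- The isometric isomorphism `w ↦ r_γ^s ŵ` of `H^{s,sγ}(ℝ²)` onto `L₂(ℝ²)`. -/
def equivL2 (b : ℕ) (s : ℝ) : AnisoSobolev b s ≃ₗᵢ[ℂ] Lp ℂ 2 (volume : Measure Plane) :=
  LinearIsometryEquiv.ofSurjective ⟨toL2, fun _ => rfl⟩ (toL2_surjective b s)

theorem equivL2_apply (b : ℕ) (s : ℝ) (w : AnisoSobolev b s) : equivL2 b s w = toL2 w := rfl

variable {b : ℕ} {s₀ s s₁ : ℝ} {φ : SlowParam} {f : Plane → ℝ}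

/-- The hypothesis says that `f` is the quotient of the two weights. It is used twice: with `f =
r_γ^{s₁-s₀}` for `J` and with `f = ψ(r_γ^{s₁-s₀})` for `ψ(J)`. -/
theorem mul_coeFn_equivL2 (hf : ∀ ξ, f ξ * rWeight b s₀ 1 ξ = rWeight b s φ ξ)
    (u : AnisoSobolev b s₀) :
    (fun ξ => (f ξ : ℂ) * equivL2 b s₀ u ξ) =ᵐ[volume]
      fun ξ => (rWeight b s φ ξ : ℂ) * u.fourier ξ := by
  filter_upwards [coeFn_toL2 u] with ξ hξ
  rw [equivL2_apply, hξ, ← hf]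
  push_cast
  ring

theorem mem_mulPMap_domain_iff (hf : ∀ ξ, f ξ * rWeight b s₀ 1 ξ = rWeight b s φ ξ)
    (u : AnisoSobolev b s₀) :
    u ∈ (mulPMap (equivL2 b s₀) f).domain ↔ toDist u ∈ refinedSobolev b s φ := by
  change MemLp (fun ξ => (f ξ : ℂ) * equivL2 b s₀ u ξ) 2 volume ↔ _
  rw [memLp_congr_ae (mul_coeFn_equivL2 hf u)]
  constructor
  · exact fun h => ⟨u.fourier, u.isFourierDensity,
      (memLp_rWeight_iff u.isFourierDensity.1.aestronglyMeasurable).1 h⟩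
  · rintro ⟨g, hg, i⟩
    refine ((memLp_rWeight_iff hg.1.aestronglyMeasurable).2 i).ae_eq ?_
    filter_upwards [hg.ae_eq u.isFourierDensity] with ξ hξ
    rw [hξ]

theorem equivL2_mulPMap (hf : ∀ ξ, f ξ * rWeight b s₀ 1 ξ = rWeight b s φ ξ)
    (u : (mulPMap (equivL2 b s₀) f).domain) (w : RefinedSobolev b s φ)
    (h : toDist (u : AnisoSobolev b s₀) = toDist w) :
    equivL2 b s₀ (mulPMap (equivL2 b s₀) f u) = toL2 w := by
  have hd : IsFourierDensity (toDist w) (u : AnisoSobolev b s₀).fourier :=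
    h ▸ (u : AnisoSobolev b s₀).isFourierDensity
  refine Lp.ext ?_
  filter_upwards [coeFn_mulPMap (equivL2 b s₀) f u, mul_coeFn_equivL2 hf (u : AnisoSobolev b s₀),
    coeFn_toL2 w, hd.ae_eq w.isFourierDensity] with ξ h1 h2 h3 h4
  rw [h1, h2, h3, h4]

theorem map_mulPMap_domain (hf : ∀ ξ, f ξ * rWeight b s₀ 1 ξ = rWeight b s φ ξ) (h : s₀ < s) :
    (mulPMap (equivL2 b s₀) f).domain.map toDist = refinedSobolev b s φ := by
  ext w
  rw [Submodule.mem_map]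
  constructor
  · rintro ⟨u, hu, rfl⟩
    exact (mem_mulPMap_domain_iff hf u).1 hu
  · intro hw
    let u : AnisoSobolev b s₀ := ⟨w, refinedSobolev_le_of_lt b φ h hw⟩
    exact ⟨u, (mem_mulPMap_domain_iff hf u).2 hw, rfl⟩

variable (b) in
theorem rpow_mul_rWeight (s₀ s₁ : ℝ) (ξ : Plane) :
    rGamma b ξ ^ (s₁ - s₀) * rWeight b s₀ 1 ξ = rWeight b s₁ 1 ξ := by
  rw [rWeight, rWeight, SlowParam.one_apply, mul_one, mul_one, ← Real.rpow_add (rGamma_pos b ξ),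
    sub_add_cancel]

theorem interpParam_mul_rWeight (h : s₀ < s₁) (ξ : Plane) :
    interpParam s₀ s s₁ φ (rGamma b ξ ^ (s₁ - s₀)) * rWeight b s₀ 1 ξ = rWeight b s φ ξ := by
  rw [interpParam_rpow φ h (one_le_rGamma b ξ), rWeight, rWeight, SlowParam.one_apply, mul_one,
    mul_right_comm, ← Real.rpow_add (rGamma_pos b ξ), sub_add_cancel]

variable (b) in
theorem measurable_rGamma_rpow (t : ℝ) : Measurable fun ξ => rGamma b ξ ^ t :=
  (continuous_rGamma b).measurable.pow_const t

/-- The operator `J` with the Fourier symbol `r_γ^{s₁-s₀}` on `H^{s₀,s₀γ}(ℝ²)`. -/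
def generator (b : ℕ) (s₀ s₁ : ℝ) : AnisoSobolev b s₀ →ₗ.[ℂ] AnisoSobolev b s₀ :=
  mulPMap (equivL2 b s₀) fun ξ => rGamma b ξ ^ (s₁ - s₀)

/-- The spectral resolution of `generator b s₀ s₁`. -/
def generatorMeasure (b : ℕ) (s₀ s₁ : ℝ) : SpectralMeasure (AnisoSobolev b s₀) :=
  mulSpectralMeasure (equivL2 b s₀) (measurable_rGamma_rpow b (s₁ - s₀))

variable (b s₀ s₁) in
theorem isIntegral_generator :
    (generatorMeasure b s₀ s₁).IsIntegral (fun t => t) (generator b s₀ s₁) :=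
  isIntegral_mulPMap (equivL2 b s₀) (measurable_rGamma_rpow b (s₁ - s₀)) measurable_id

variable (b) in
theorem generator_domain (h : s₀ < s₁) :
    (generator b s₀ s₁).domain = LinearMap.range (embed b h.le) := by
  ext u
  rw [generator, mem_mulPMap_domain_iff (rpow_mul_rWeight b s₀ s₁), LinearMap.mem_range]
  constructor
  · intro hu
    exact ⟨⟨toDist u, hu⟩, toDist_injective rfl⟩
  · rintro ⟨v, rfl⟩
    exact v.2

variable (b) in
theorem norm_embed_le (h : s₀ ≤ s₁) (v : AnisoSobolev b s₁) : ‖embed b h v‖ ≤ ‖v‖ := by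
  change ‖toL2 (embed b h v)‖ ≤ ‖toL2 v‖
  refine Lp.norm_le_norm_of_ae_le ?_
  have hd : IsFourierDensity (toDist v) (embed b h v).fourier := (embed b h v).isFourierDensity
  filter_upwards [coeFn_toL2 (embed b h v), coeFn_toL2 v, hd.ae_eq v.isFourierDensity]
    with ξ h1 h2 h3
  rw [h1, h2, h3, norm_mul, norm_mul, Complex.norm_real, Complex.norm_real, Real.norm_eq_abs,
    Real.norm_eq_abs, abs_of_pos (rWeight_pos b s₀ 1 ξ), abs_of_pos (rWeight_pos b s₁ 1 ξ)]
  refine mul_le_mul_of_nonneg_right ?_ (norm_nonneg _)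
  rw [rWeight, rWeight, SlowParam.one_apply, mul_one, mul_one]
  exact Real.rpow_le_rpow_of_exponent_le (one_le_rGamma b ξ) h

instance (b : ℕ) (s : ℝ) : TopologicalSpace.SeparableSpace (AnisoSobolev b s) :=
  have : Fact ((1 : ℝ≥0∞) ≤ 2) := ⟨one_le_two⟩
  have : Fact ((2 : ℝ≥0∞) ≠ ∞) := ⟨ENNReal.ofNat_ne_top⟩
  (equivL2 b s).symm.surjective.denseRange.separableSpace (equivL2 b s).symm.continuous

variable (b) in
theorem isAdmissibleCouple_embed (h : s₀ < s₁) : IsAdmissibleCouple (embed b h.le) where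
  complete₀ := inferInstance
  complete₁ := inferInstance
  separable₀ := inferInstance
  separable₁ := inferInstance
  injective := Submodule.inclusion_injective _
  continuous := (LinearMap.mkContinuous (embed b h.le) 1 fun v => by
    rw [one_mul]; exact norm_embed_le b h.le v).continuous
  dense := by
    -- Density of the embedding is density of the domain of the multiplication operator, which is
    -- its range.
    have hd := (isIntegral_generator b s₀ s₁).dense_domain measurable_id
    rwa [generator_domain b h] at hd

theorem toL2_embed (h : s₀ < s₁) (v : AnisoSobolev b s₁) (u : (generator b s₀ s₁).domain)
    (hu : (u : AnisoSobolev b s₀) = embed b h.le v) :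
    equivL2 b s₀ (generator b s₀ s₁ u) = equivL2 b s₁ v :=
  equivL2_mulPMap (rpow_mul_rWeight b s₀ s₁) u v (by rw [hu, toDist_embed])

theorem generator_surjective (h : s₀ < s₁) (x : AnisoSobolev b s₀) :
    ∃ u : (generator b s₀ s₁).domain, generator b s₀ s₁ u = x := by
  set v := (equivL2 b s₁).symm (equivL2 b s₀ x) with hv
  have hu : embed b h.le v ∈ (generator b s₀ s₁).domain := by
    rw [generator_domain b h]
    exact ⟨v, rfl⟩
  refine ⟨⟨_, hu⟩, (equivL2 b s₀).injective ?_⟩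
  rw [toL2_embed h v ⟨_, hu⟩ rfl, hv, (equivL2 b s₁).apply_symm_apply]

theorem isGeneratingOperator_generator (h : s₀ < s₁) :
    IsGeneratingOperator (embed b h.le) (generator b s₀ s₁) where
  domain_eq := generator_domain b h
  isometricIso := by
    refine ⟨(equivL2 b s₁).trans (equivL2 b s₀).symm, fun v u hu => ?_⟩
    refine (equivL2 b s₀).injective ?_
    rw [toL2_embed h v u hu, LinearIsometryEquiv.trans_apply, (equivL2 b s₀).apply_symm_apply]
  selfAdjoint := LinearPMap.isSelfAdjoint_of_surjective
    ((isIntegral_generator b s₀ s₁).dense_domain measurable_id)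
    (inner_mulPMap (equivL2 b s₀) _) (generator_surjective h)
  positive u hu := by
    have hle : ‖(u : AnisoSobolev b s₀)‖ ^ 2 ≤
        (⟪(u : AnisoSobolev b s₀), generator b s₀ s₁ u⟫_ℂ).re := by
      -- The symbol is at least 1 because `r_γ ≥ 1`, so the spectral measure is carried by `[1,∞)`
      -- and `(u, Ju) ≥ ‖u‖²`.
      have h1 : (generatorMeasure b s₀ s₁).proj (Ici 1) (u : AnisoSobolev b s₀) = u := by
        rw [generatorMeasure, mulSpectralMeasure_proj _ _ measurableSet_Ici,
          LinearIsometryEquiv.symm_apply_eq]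
        refine Lp.ext ?_
        filter_upwards [coeFn_indicatorLp (measurable_rGamma_rpow b (s₁ - s₀) measurableSet_Ici)
          (equivL2 b s₀ (u : AnisoSobolev b s₀))] with ξ hξ
        have hmem : ξ ∈ (fun ξ => rGamma b ξ ^ (s₁ - s₀)) ⁻¹' Ici 1 :=
          Real.one_le_rpow (one_le_rGamma b ξ) (sub_pos.2 h).le
        rw [hξ, indicator_of_mem hmem]
      have := (isIntegral_generator b s₀ s₁).le_re_inner u h1
      rwa [one_mul] at this
    exact (pow_pos (norm_pos_iff.2 hu) 2).trans_le hle

end AnisoSobolev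

end

theorem lemma5p1 (b : ℕ) (hb : 1 ≤ b) (s s₀ s₁ : ℝ) (h₀ : s₀ < s) (h₁ : s < s₁) (φ : SlowParam) :
    -- the couple `[H^{s₀,s₀γ}, H^{s₁,s₁γ}]` is admissible, and `ψ` belongs to the class `𝓑`
    IsAdmissibleCouple (AnisoSobolev.embed b (h₀.trans h₁).le) ∧
    IsClassB (interpParam s₀ s s₁ φ) ∧
    -- the couple has a unique generating operator `J`
    (∃! J : AnisoSobolev b s₀ →ₗ.[ℂ] AnisoSobolev b s₀,
      IsGeneratingOperator (AnisoSobolev.embed b (h₀.trans h₁).le) J) ∧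
    ∀ J : AnisoSobolev b s₀ →ₗ.[ℂ] AnisoSobolev b s₀,
      IsGeneratingOperator (AnisoSobolev.embed b (h₀.trans h₁).le) J →
      -- the operator `ψ(J)` is well defined
      (∃! T : AnisoSobolev b s₀ →ₗ.[ℂ] AnisoSobolev b s₀,
        IsBorelFunctionOf (interpParam s₀ s s₁ φ) J T) ∧
      -- its domain, normed by `‖ψ(J) u‖`, is `H^{s,sγ,φ}` with equality of norms
      ∀ T : AnisoSobolev b s₀ →ₗ.[ℂ] AnisoSobolev b s₀,
        IsBorelFunctionOf (interpParam s₀ s s₁ φ) J T →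
        T.domain.map RefinedSobolev.toDist = refinedSobolev b s φ ∧
        ∀ (u : T.domain) (w : RefinedSobolev b s φ),
          RefinedSobolev.toDist (u : AnisoSobolev b s₀) = RefinedSobolev.toDist w →
          ‖T u‖ = ‖w‖ := by
  have h : s₀ < s₁ := h₀.trans h₁
  have hψ := measurable_interpParam s₀ s s₁ φ h
  have hG := AnisoSobolev.isGeneratingOperator_generator (b := b) h
  have hι := AnisoSobolev.isAdmissibleCouple_embed b h
  have hE := AnisoSobolev.isIntegral_generator b s₀ s₁
  have hT : (AnisoSobolev.generatorMeasure b s₀ s₁).IsIntegral (interpParam s₀ s s₁ φ)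
      (mulPMap (AnisoSobolev.equivL2 b s₀) fun ξ =>
        interpParam s₀ s s₁ φ (rGamma b ξ ^ (s₁ - s₀))) :=
    isIntegral_mulPMap (AnisoSobolev.equivL2 b s₀)
      (AnisoSobolev.measurable_rGamma_rpow b (s₁ - s₀)) hψ
  -- `T` may come from another resolution `F` of `J`, but `F` has the same scalar measures as the
  -- explicit one.
  have huniq : ∀ T, IsBorelFunctionOf (interpParam s₀ s s₁ φ) (AnisoSobolev.generator b s₀ s₁) T →
      T = mulPMap (AnisoSobolev.equivL2 b s₀) fun ξ =>
        interpParam s₀ s s₁ φ (rGamma b ξ ^ (s₁ - s₀)) := by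
    rintro T ⟨F, hFJ, hFT⟩
    exact hFT.unique hT hψ (hFJ.scalar_eq hE (hG.inner_apply_right hι.dense) hG.positive
      (AnisoSobolev.generator_surjective h))
  refine ⟨hι, isClassB_interpParam φ h₀ h₁, ⟨_, hG, fun J hJ => hJ.unique hι hG⟩,
    fun J hJ => ?_⟩
  -- Uniqueness replaces an arbitrary generating operator by the multiplication operator, where
  -- `ψ(J)` is explicit.
  obtain rfl : J = AnisoSobolev.generator b s₀ s₁ := hJ.unique hι hG
  refine ⟨⟨_, ⟨_, hE, hT⟩, huniq⟩, fun T hBT => ?_⟩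
  obtain rfl := huniq T hBT
  refine ⟨AnisoSobolev.map_mulPMap_domain (fun ξ => AnisoSobolev.interpParam_mul_rWeight h ξ) h₀,
    fun u w huw => ?_⟩
  rw [← (AnisoSobolev.equivL2 b s₀).norm_map,
    AnisoSobolev.equivL2_mulPMap (fun ξ => AnisoSobolev.interpParam_mul_rWeight h ξ) u w huw]
  rfl
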